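/- Work over the structure $\mathfrak R=(\mathbb R;\,+,\ (x\mapsto cx)_{c\in\mathbb R},\ (c)_{c\in\mathbb R})$, the real numbers with addition, all scalar multiplications and all constants. For a family $\tau$ of relations $R\subseteq\mathbb R^n$ ($n\ge 0$ may vary), write $(\mathfrak R,\tau)$ for $\mathfrak R$ expanded by a relation symbol for every member of $\tau$. Infinitary pp-formulas are the formulas built from true, false and atomic formulas by substitution of variables, existential quantification, and finite or infinite conjunctions having finitely many free variables. A set $T\subseteq\mathbb R^m$ is infinitary pp-definable from $\tau$ if it is defined in $(\mathfrak R,\tau)$ by an infinitary pp-formula; $S$ and $T$ are infinitary pp-interdefinable if $S$ is infinitary pp-definable from $\{T\}$ and $T$ from $\{S\}$. For a convex set $S\subseteq\mathbb R^n$, a *semident* of $S$ is a point $a\notin S$ of the form $a=\lambda s+(1-\lambda)t$ with $s\in S$, $t\in\overline S$, $\lambda\in(0,1)$. The set $S$ has a *ray intersection* if there are $v,w\in\mathbb R^n$ with $v+xw\in S$ for all real $x>0$ and $v+xw\notin S$ for all real $x<0$. Sums of sets are Minkowski sums $B+V=\{b+v\mid b\in B,\ v\in V\}$. **Theorem.**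 A convex set $S\subseteq\mathbb R^n$ is infinitary pp-interdefinable 1. with $\{0\}\subset\mathbb R$ if and only if $S$ is empty or an affine subspace; 2. with $[0,1]\subset\mathbb R$ if and only if $S$ is neither empty nor an affine subspace, but is the sum $B+V$ of a compact convex set $B\subseteq\mathbb R^n$ and a vector subspace $V\subseteq\mathbb R^n$; 3. with $(0,1)\subset\mathbb R$ if and only if $S$ is not closed, has no semident, and is the sum $B+V$ of a bounded convex set $B\subseteq\mathbb R^n$ and a vector subspace $V\subseteq\mathbb R^n$; 4. with the pointed rectangle $\big((-1,1)\times(0,1)\big)\cup\{(0,0)\}\subset\mathbb R^2$ if and only if $S$ is the sum $B+V$ of a bounded convex set $B\subseteq\mathbb R^n$ and a vector subspace $V\subseteq\mathbb R^n$, and $S$ has a semident; 5. with the pointed stripe $\big(\mathbb R\times(0,1)\big)\cup\{(0,0)\}\subset\mathbb R^2$ if and only if $S$ is not the sum of a bounded set and a vector subspace, and has no ray intersection; 6. with $[0,\infty)\subset\mathbb R$ if and only if $S$ has a ray intersection. Every convex set $S\subseteq\mathbb R^n$ is in exactly one of these six classes. Moreover, if $S$ is a convex set in class $k$, then a set $T\subseteq\mathbb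 R^m$ (with $m$ arbitrary) is infinitary pp-definable from $\{S\}$ if and only if $T$ is convex and belongs to a class with number $j\le k$. Finally, if $\tau$ is any family of convex sets, then every set that is infinitary pp-definable from $\tau$ is convex. -/

import Mathlib

open scoped Pointwise

namespace ConvexPP

/-! ### Infinitary primitive positive formulas -/

/-- Infinitary primitive positive formulas over a first-order language `L`, whose free variables are
among `n` given ones. They are built from true, false and the atomic formulas by substituting
variables, by finite or infinite conjunctions, and by existential quantification. Since all members
of a conjunction share the same `n` variables, a conjunction always has finitely many free
variables. -/
inductive IPPFormula (L : FirstOrder.Language.{0, 0}) : ℕ → Type 1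
  | verum {n : ℕ} : IPPFormula L n
  | falsum {n : ℕ} : IPPFormula L n
  | equal {n : ℕ} (t₁ t₂ : L.Term (Fin n)) : IPPFormula L n
  | rel {n k : ℕ} (R : L.Relations k) (ts : Fin k → L.Term (Fin n)) : IPPFormula L n
  | rename {m n : ℕ} (f : Fin m → Fin n) (φ : IPPFormula L m) : IPPFormula L n
  | conj {n : ℕ} {ι : Type} (φ : ι → IPPFormula L n) : IPPFormula L n
  | ex {n : ℕ} (φ : IPPFormula L (n + 1)) : IPPFormula L n

/-- Truth of an infinitary pp-formula in an `L`-structure under an assignment of its variables. -/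
def IPPFormula.Realize {L : FirstOrder.Language.{0, 0}} {M : Type} [L.Structure M] :
    {n : ℕ} → IPPFormula L n → (Fin n → M) → Prop
  | _, .verum, _ => True
  | _, .falsum, _ => False
  | _, .equal t₁ t₂, v => t₁.realize v = t₂.realize v
  | _, .rel R ts, v => FirstOrder.Language.Structure.RelMap R fun i => (ts i).realize v
  | _, .rename f φ, v => φ.Realize (v ∘ f)
  | _, .conj φ, v => ∀ i, (φ i).Realize v
  | _, .ex φ, v => ∃ a : M, φ.Realize (Fin.snoc (α := fun _ => M) v a)

/-! ### The structure `(ℝ; +, · c, c, τ)` -/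

/-- A subset of `ℝⁿ` together with its dimension `n`. -/
abbrev RealRel : Type := Σ n : ℕ, Set (Fin n → ℝ)

/-- The function symbols: a constant for every real number, multiplication by every real number,
and addition. -/
inductive AffineFunction : ℕ → Type
  | const (c : ℝ) : AffineFunction 0
  | smul (c : ℝ) : AffineFunction 1
  | add : AffineFunction 2

/-- The language with addition, scalar multiplications, all constants, and one relation symbol for
every member of the family `τ`. -/
def lang (τ : Set RealRel) : FirstOrder.Language.{0, 0} where
  Functions := AffineFunction
  Relations n := {T : Set (Fin n → ℝ) // (⟨n, T⟩ : RealRel) ∈ τ}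

/-- Interpretation of the function symbols. -/
def AffineFunction.eval : {n : ℕ} → AffineFunction n → (Fin n → ℝ) → ℝ
  | _, .const c, _ => c
  | _, .smul c, x => c * x 0
  | _, .add, x => x 0 + x 1

/-- The structure on `ℝ`: each symbol for a member of `τ` is interpreted as that member. -/
instance (τ : Set RealRel) : (lang τ).Structure ℝ where
  funMap f x := AffineFunction.eval f x
  RelMap R x := x ∈ R.1

/-- `T ⊆ ℝᵐ` is infinitary pp-definable over `(ℝ; +, · c, c, τ)`. -/
def IPPDefinable (τ : Set RealRel) {m : ℕ} (T : Set (Fin m → ℝ)) : Prop :=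
  ∃ φ : IPPFormula (lang τ) m, ∀ x : Fin m → ℝ, x ∈ T ↔ φ.Realize x

/-- `T` is infinitary pp-definable over `(ℝ; +, · c, c, S)`. -/
def DefinableFrom {n m : ℕ} (S : Set (Fin n → ℝ)) (T : Set (Fin m → ℝ)) : Prop :=
  IPPDefinable {⟨n, S⟩} T

/-- Infinitary pp-interdefinability over `(ℝ; +, · c, c)`. -/
def Interdefinable {n m : ℕ} (S : Set (Fin n → ℝ)) (T : Set (Fin m → ℝ)) : Prop :=
  DefinableFrom T S ∧ DefinableFrom S T

/-! ### Geometric notions -/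

/-- `S` is an affine subspace or empty (Mathlib's affine subspaces include the empty one). -/
def IsEmptyOrAffine {n : ℕ} (S : Set (Fin n → ℝ)) : Prop :=
  ∃ A : AffineSubspace ℝ (Fin n → ℝ), S = (A : Set (Fin n → ℝ))

/-- `S` is the sum of a compact convex set and a vector subspace. -/
def IsCompactPlusSubspace {n : ℕ} (S : Set (Fin n → ℝ)) : Prop :=
  ∃ (B : Set (Fin n → ℝ)) (V : Submodule ℝ (Fin n → ℝ)),
    IsCompact B ∧ Convex ℝ B ∧ S = B + (V : Set (Fin n → ℝ))

/-- `S` is the sum of a bounded convex set and a vector subspace. -/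
def IsBoundedConvexPlusSubspace {n : ℕ} (S : Set (Fin n → ℝ)) : Prop :=
  ∃ (B : Set (Fin n → ℝ)) (V : Submodule ℝ (Fin n → ℝ)),
    Bornology.IsBounded B ∧ Convex ℝ B ∧ S = B + (V : Set (Fin n → ℝ))

/-- `S` is the sum of a bounded set and a vector subspace. -/
def IsBoundedPlusSubspace {n : ℕ} (S : Set (Fin n → ℝ)) : Prop :=
  ∃ (B : Set (Fin n → ℝ)) (V : Submodule ℝ (Fin n → ℝ)),
    Bornology.IsBounded B ∧ S = B + (V : Set (Fin n → ℝ))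

/-- The point `a` is a semident of `S`. -/
def IsSemident {n : ℕ} (S : Set (Fin n → ℝ)) (a : Fin n → ℝ) : Prop :=
  a ∉ S ∧ ∃ s ∈ S, ∃ t ∈ closure S, ∃ c ∈ Set.Ioo (0 : ℝ) 1, a = c • s + (1 - c) • t

/-- `S` has a ray intersection. -/
def HasRayIntersection {n : ℕ} (S : Set (Fin n → ℝ)) : Prop :=
  ∃ v w : Fin n → ℝ, (∀ x : ℝ, 0 < x → v + x • w ∈ S) ∧ (∀ x : ℝ, x < 0 → v + x • w ∉ S)

/-! ### The six representatives -/

/-- The point `{0} ⊆ ℝ`. -/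
def point : Set (Fin 1 → ℝ) := {x | x 0 = 0}

/-- The compact interval `[0,1] ⊆ ℝ`. -/
def closedInterval : Set (Fin 1 → ℝ) := {x | x 0 ∈ Set.Icc (0 : ℝ) 1}

/-- The open interval `(0,1) ⊆ ℝ`. -/
def openInterval : Set (Fin 1 → ℝ) := {x | x 0 ∈ Set.Ioo (0 : ℝ) 1}

/-- The pointed rectangle `(-1,1) × (0,1) ∪ {(0,0)} ⊆ ℝ²`. -/
def pointedRectangle : Set (Fin 2 → ℝ) :=
  {x | (x 0 ∈ Set.Ioo (-1 : ℝ) 1 ∧ x 1 ∈ Set.Ioo (0 : ℝ) 1) ∨ (x 0 = 0 ∧ x 1 = 0)}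

/-- The pointed stripe `ℝ × (0,1) ∪ {(0,0)} ⊆ ℝ²`. -/
def pointedStripe : Set (Fin 2 → ℝ) :=
  {x | x 1 ∈ Set.Ioo (0 : ℝ) 1 ∨ (x 0 = 0 ∧ x 1 = 0)}

/-- The closed ray `[0,∞) ⊆ ℝ`. -/
def ray : Set (Fin 1 → ℝ) := {x | 0 ≤ x 0}

/-- The six representatives, in increasing order of class number. -/
def representative : Fin 6 → RealRel :=
  ![⟨1, point⟩, ⟨1, closedInterval⟩, ⟨1, openInterval⟩,
    ⟨2, pointedRectangle⟩, ⟨2, pointedStripe⟩, ⟨1, ray⟩]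

/-- `S` is infinitary pp-interdefinable with the representative number `k` (counted from `0`). -/
def InClass (k : Fin 6) {n : ℕ} (S : Set (Fin n → ℝ)) : Prop :=
  Interdefinable S (representative k).2

end ConvexPP

/-! The classes are the successive differences of an increasing chain of families `ClassAtMost k`:
empty or affine; closed and drift invariant; drift invariant without semident; drift invariant;
`NoRay`; convex. The drift of a set consists of the directions killed by every functional bounded on
the set. Invariance under it is the same as being a bounded set plus a subspace, but it passes more
easily through intersections, preimages and images.

Nothing definable from a member of a family leaves the family, because each family is closed under
affine preimages, arbitrary intersections and projections (`ClassAtMost.ppClosed`), which are the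
formation rules of pp-formulas. Projection is the delicate case. It rests on lifting drift through
linear maps (`exists_drift_lift`), on lifting limit points (`DriftInvariant.closure_image_subset`),
and on the fact that a convex set without rays contains a translate of its drift
(`NoRay.exists_add_drift_mem`, whence `NoRay.image`).

The representative defines its whole family (`ClassAtMost.of_representative`). A closed set is an
intersection of slabs. Without semidents, a missing boundary point is cut off by a function
vanishing exactly on its face (`Def.of_bounded_noSemident`). In the three largest families each
outside point is separated lexicographically, by recursion on hyperplane sections
(`exists_def_separating`); the representative only has to express "first coordinate positive, or
both zero" within the bounds available.

A set in one family but not in the preceding one defines the representative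
(`PPClosed.representative`): some trace on a line or plane shows the failure of the smaller family,
and intersections of its translates carve out the required shape. Together with the level of each
representative this gives `inClass_iff`, from which the theorem follows. -/

namespace ConvexPP

/-! ### Convex geometry in finite dimension -/

section Geometry

open Set

/-- Every ray contained in `S` extends to a full line contained in `S`. -/
def NoRay {E : Type*} [AddCommGroup E] [Module ℝ E] (S : Set E) : Prop :=
  ∀ v w : E, (∀ x : ℝ, 0 < x → v + x • w ∈ S) → ∀ x : ℝ, v + x • w ∈ S

/-- The linear functionals that are bounded on `S`. -/
def bddDual {E : Type*} [AddCommGroup E] [Module ℝ E] (S : Set E) :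
    Submodule ℝ (Module.Dual ℝ E) where
  carrier := {f | ∃ c, ∀ s ∈ S, |f s| ≤ c}
  zero_mem' := ⟨0, by simp⟩
  add_mem' := by
    rintro f g ⟨c, hc⟩ ⟨d, hd⟩
    exact ⟨c + d, fun s hs => (abs_add_le _ _).trans (add_le_add (hc s hs) (hd s hs))⟩
  smul_mem' := by
    rintro r f ⟨c, hc⟩
    refine ⟨|r| * c, fun s hs => ?_⟩
    simpa [abs_mul] using mul_le_mul_of_nonneg_left (hc s hs) (abs_nonneg r)

/-- The directions that are killed by all functionals bounded on `S`. -/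
def drift {E : Type*} [AddCommGroup E] [Module ℝ E] (S : Set E) : Submodule ℝ E :=
  (bddDual S).dualCoannihilator

/-- `S` is invariant under translation by all of its drift. -/
def DriftInvariant {E : Type*} [AddCommGroup E] [Module ℝ E] (S : Set E) : Prop :=
  ∀ w ∈ drift S, ∀ s ∈ S, s + w ∈ S

/-- `S` has no semident. -/
def NoSemident {E : Type*} [TopologicalSpace E] [AddCommGroup E] [Module ℝ E] (S : Set E) : Prop :=
  ∀ s ∈ S, ∀ t ∈ closure S, ∀ c ∈ Ioo (0 : ℝ) 1, c • s + (1 - c) • t ∈ S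

/-! ### Drift and its behaviour under linear operations -/

section Algebraic

variable {E F : Type*} [AddCommGroup E] [Module ℝ E] [AddCommGroup F] [Module ℝ F]

theorem mem_bddDual {S : Set E} {f : Module.Dual ℝ E} :
    f ∈ bddDual S ↔ ∃ c, ∀ s ∈ S, |f s| ≤ c := Iff.rfl

theorem mem_drift {S : Set E} {w : E} : w ∈ drift S ↔ ∀ f ∈ bddDual S, f w = 0 :=
  Submodule.mem_dualCoannihilator _

theorem mem_bddDual_image {S : Set E} {f : E →ₗ[ℝ] F} {φ : Module.Dual ℝ F} :
    φ ∈ bddDual (f '' S) ↔ φ ∘ₗ f ∈ bddDual S := by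
  simp [mem_bddDual]

theorem bddDual_anti {S T : Set E} (h : S ⊆ T) : bddDual T ≤ bddDual S :=
  fun _ ⟨c, hc⟩ => ⟨c, fun s hs => hc s (h hs)⟩

theorem drift_mono {S T : Set E} (h : S ⊆ T) : drift S ≤ drift T :=
  fun _ hw => mem_drift.2 fun f hf => mem_drift.1 hw f (bddDual_anti h hf)

/-- In finite dimension the double annihilator of `bddDual S` is `bddDual S` itself, so the drift
determines which functionals are bounded. -/
theorem mem_bddDual_of_drift [FiniteDimensional ℝ E] {S : Set E} {f : Module.Dual ℝ E}
    (h : ∀ w ∈ drift S, f w = 0) : f ∈ bddDual S := by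
  have : f ∈ (drift S).dualAnnihilator := (Submodule.mem_dualAnnihilator f).2 h
  rwa [drift, Subspace.dualCoannihilator_dualAnnihilator_eq] at this

theorem exists_dual_ne_zero {V : Submodule ℝ E} {w : E} (hw : w ∉ V) :
    ∃ φ : Module.Dual ℝ E, (∀ v ∈ V, φ v = 0) ∧ φ w ≠ 0 := by
  obtain ⟨φ, h1, h2⟩ := Submodule.exists_le_ker_of_notMem hw
  exact ⟨φ, fun v hv => h2 hv, h1⟩

/-- If `w` were outside the image of the drift, a functional vanishing on that image but not at `w`
would pull back to one vanishing on `drift S`. That one is bounded on `S`, so the functional is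
bounded on `f '' S` and must kill `w`. -/
theorem exists_drift_lift [FiniteDimensional ℝ E] {S : Set E} (f : E →ₗ[ℝ] F)
    {w : F} (hw : w ∈ drift (f '' S)) : ∃ u ∈ drift S, f u = w := by
  by_contra! h
  have hmem : w ∉ (drift S).map f := by
    rintro ⟨u, hu, rfl⟩
    exact h u hu rfl
  obtain ⟨φ, h1, h2⟩ := exists_dual_ne_zero hmem
  refine h2 (mem_drift.1 hw φ (mem_bddDual_image.2 (mem_bddDual_of_drift fun v hv => ?_)))
  exact h1 _ (Submodule.mem_map_of_mem hv)

theorem DriftInvariant.sub_mem {S : Set E} (h : DriftInvariant S) {w s : E} (hw : w ∈ drift S)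
    (hs : s ∈ S) : s - w ∈ S := by
  simpa [sub_eq_add_neg] using h _ (neg_mem hw) s hs

/-- A functional bounded on a ray vanishes on its direction, so directions of rays in `S` belong to
the drift. -/
theorem DriftInvariant.noRay {S : Set E} (h : DriftInvariant S) : NoRay S := by
  intro v w hvw x
  have hw : w ∈ drift S := by
    refine mem_drift.2 fun f ⟨c, hc⟩ => ?_
    by_contra h0
    have key : ∀ y : ℝ, 0 < y → y * |f w| ≤ c + |f v| := by
      intro y hy
      have h1 := hc _ (hvw y hy)
      simp only [map_add, map_smul, smul_eq_mul] at h1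
      calc y * |f w| = |(f v + y * f w) - f v| := by simp [abs_mul, abs_of_pos hy]
        _ ≤ |f v + y * f w| + |f v| := abs_sub _ _
        _ ≤ _ := by gcongr
    have hpos : 0 < |f w| := abs_pos.2 h0
    have hc0 : 0 ≤ c := (abs_nonneg _).trans (hc _ (hvw 1 one_pos))
    have := key ((c + |f v| + 1) / |f w|) (by positivity)
    rw [div_mul_cancel₀ _ hpos.ne'] at this
    linarith
  have h1 := h _ (Submodule.smul_mem _ (x - 1) hw) _ (hvw 1 one_pos)
  convert h1 using 1
  module

theorem NoRay.iInter {ι : Type*} {S : ι → Set E} (h : ∀ i, NoRay (S i)) : NoRay (⋂ i, S i) :=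
  fun v w hvw x => mem_iInter.2 fun i => h i v w (fun y hy => mem_iInter.1 (hvw y hy) i) x

theorem NoRay.inter {S T : Set E} (hS : NoRay S) (hT : NoRay T) : NoRay (S ∩ T) :=
  fun v w hvw x => ⟨hS v w (fun y hy => (hvw y hy).1) x, hT v w (fun y hy => (hvw y hy).2) x⟩

theorem NoRay.preimage {T : Set F} (h : NoRay T) (g : E →ᵃ[ℝ] F) : NoRay (g ⁻¹' T) := by
  have key : ∀ (v w : E) (x : ℝ), g (v + x • w) = g v + x • g.linear w := by
    intro v w x
    have := g.map_vadd v (x • w)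
    simp only [vadd_eq_add, map_smul] at this
    rw [add_comm, this, add_comm]
  intro v w hvw x
  simp only [mem_preimage, key] at hvw ⊢
  exact h _ _ hvw x

theorem DriftInvariant.iInter {ι : Type*} {S : ι → Set E} (h : ∀ i, DriftInvariant (S i)) :
    DriftInvariant (⋂ i, S i) :=
  fun w hw s hs => mem_iInter.2 fun i =>
    h i w (drift_mono (iInter_subset _ i) hw) s (mem_iInter.1 hs i)

theorem DriftInvariant.inter {S T : Set E} (hS : DriftInvariant S) (hT : DriftInvariant T) :
    DriftInvariant (S ∩ T) :=
  fun w hw s hs => ⟨hS w (drift_mono inter_subset_left hw) s hs.1,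
    hT w (drift_mono inter_subset_right hw) s hs.2⟩

theorem affineMap_add_apply (g : E →ᵃ[ℝ] F) (s w : E) : g (s + w) = g s + g.linear w := by
  have := g.map_vadd s w
  simp only [vadd_eq_add] at this
  rw [add_comm, this, add_comm]

theorem DriftInvariant.preimage {T : Set F} (h : DriftInvariant T) (g : E →ᵃ[ℝ] F) :
    DriftInvariant (g ⁻¹' T) := by
  intro w hw s hs
  rw [mem_preimage, affineMap_add_apply]
  -- The linear part of `g` carries drift to drift: pulling back a functional bounded on `T` changes
  -- its bound only by the constant `f (g 0)`.
  refine h _ (mem_drift.2 fun f ⟨c, hc⟩ => ?_) _ hs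
  refine mem_drift.1 hw (f ∘ₗ g.linear) ⟨c + |f (g 0)|, fun x hx => ?_⟩
  have h1 := hc _ hx
  have h2 : f (g.linear x) = f (g x) - f (g 0) := by
    have := affineMap_add_apply g 0 x
    rw [zero_add] at this
    simp [this]
  rw [LinearMap.comp_apply, h2]
  exact (abs_sub _ _).trans (by gcongr)

theorem DriftInvariant.image [FiniteDimensional ℝ E] {S : Set E} (h : DriftInvariant S)
    (f : E →ₗ[ℝ] F) : DriftInvariant (f '' S) := by
  rintro w hw _ ⟨s, hs, rfl⟩
  obtain ⟨u, hu, rfl⟩ := exists_drift_lift f hw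
  exact ⟨s + u, h u hu s hs, map_add _ _ _⟩

theorem DriftInvariant.empty : DriftInvariant (∅ : Set E) := fun _ _ _ h => h.elim

theorem drift_add_submodule_le [FiniteDimensional ℝ E] {B : Set E} {V : Submodule ℝ E}
    (hB : ∀ f : Module.Dual ℝ E, f ∈ bddDual B) : drift (B + (V : Set E)) ≤ V := by
  intro w hw
  by_contra hwV
  obtain ⟨φ, h1, h2⟩ := exists_dual_ne_zero hwV
  refine h2 (mem_drift.1 hw φ ?_)
  obtain ⟨c, hc⟩ := hB φ
  refine ⟨c, ?_⟩
  rintro _ ⟨b, hb, v, hv, rfl⟩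
  simpa [h1 v hv] using hc b hb

end Algebraic

/-! ### Bounded slices, recession directions and separation -/

section Normed

variable {E F : Type*} [NormedAddCommGroup E] [NormedSpace ℝ E] [FiniteDimensional ℝ E]
  [AddCommGroup F] [Module ℝ F]

theorem mem_bddDual_of_isBounded {B : Set E} (hB : Bornology.IsBounded B) (f : Module.Dual ℝ E) :
    f ∈ bddDual B := by
  obtain ⟨c, hc⟩ := hB.exists_norm_le
  refine ⟨‖LinearMap.toContinuousLinearMap f‖ * c, fun s hs => ?_⟩
  calc |f s| = ‖LinearMap.toContinuousLinearMap f s‖ := rfl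
    _ ≤ ‖LinearMap.toContinuousLinearMap f‖ * ‖s‖ := ContinuousLinearMap.le_opNorm _ _
    _ ≤ _ := by gcongr; exact hc s hs

theorem isBounded_of_bddDual {B : Set E} (h : ∀ f : Module.Dual ℝ E, f ∈ bddDual B) :
    Bornology.IsBounded B := by
  let e := (Module.finBasis ℝ E).equivFunL
  choose c hc using fun i => h ((LinearMap.proj i) ∘ₗ (e : E →ₗ[ℝ] (Fin (Module.finrank ℝ E) → ℝ)))
  have h1 : Bornology.IsBounded (e '' B) := by
    refine (Bornology.IsBounded.pi (S := fun i => Metric.closedBall (0:ℝ) (c i))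
      fun i => Metric.isBounded_closedBall).subset ?_
    rintro _ ⟨b, hb, rfl⟩ i -
    simpa using hc i b hb
  have h2 := (e.symm : _ →L[ℝ] E).lipschitz.isBounded_image h1
  convert h2 using 1
  ext x
  simp [image_image]

theorem driftInvariant_add_submodule {B : Set E} (hB : Bornology.IsBounded B)
    (V : Submodule ℝ E) : DriftInvariant (B + (V : Set E)) := by
  intro w hw
  have hwV := drift_add_submodule_le (mem_bddDual_of_isBounded hB) hw
  rintro _ ⟨b, hb, v, hv, rfl⟩
  exact ⟨b, hb, v + w, V.add_mem hv hwV, (add_assoc _ _ _).symm⟩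

/-- A drift invariant set is the preimage of a bounded set under a linear projection. -/
theorem DriftInvariant.exists_projection {S : Set E} (h : DriftInvariant S) :
    ∃ P : E →ₗ[ℝ] E, (∀ x, P (P x) = P x) ∧ (∀ x, P x ∈ S ↔ x ∈ S) ∧
      (∀ x, x - P x ∈ drift S) ∧ Bornology.IsBounded (P '' S) := by
  obtain ⟨W, hW⟩ := (drift S).exists_isCompl
  let P := W.projection (drift S) hW.symm
  have hdiff : ∀ x, x - P x ∈ drift S := by
    intro x
    rw [← Submodule.projection_apply_eq_zero_iff hW.symm]
    change P (x - P x) = 0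
    rw [map_sub, sub_eq_zero]
    exact (Submodule.projection_apply_of_mem_left hW.symm
      (Submodule.projection_apply_mem hW.symm x)).symm
  refine ⟨P, fun x => Submodule.projection_apply_of_mem_left hW.symm
      (Submodule.projection_apply_mem hW.symm x), fun x => ⟨fun hx => ?_, fun hx => ?_⟩, hdiff, ?_⟩
  · have := h _ (hdiff x) _ hx
    rwa [add_sub_cancel] at this
  · have := h.sub_mem (hdiff x) hx
    rwa [sub_sub_cancel] at this
  -- Every functional composed with `P` kills the drift, hence is bounded on `S`.
  · refine isBounded_of_bddDual fun f => mem_bddDual_image.2 (mem_bddDual_of_drift fun w hw => ?_)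
    have : P w = 0 := (Submodule.projection_apply_eq_zero_iff hW.symm).2 hw
    simp [this]

/-- A nonempty convex set has a point from which every point of the closure can be seen
through the set. -/
theorem exists_core_point {S : Set E} (hS : Convex ℝ S) (hne : S.Nonempty) :
    ∃ u ∈ S, ∀ t ∈ closure S, ∀ c ∈ Ioc (0 : ℝ) 1, c • u + (1 - c) • t ∈ S := by
  obtain ⟨u, hu⟩ := hne.intrinsicInterior hS
  obtain ⟨y, hy, rfl⟩ := mem_intrinsicInterior.1 hu
  obtain ⟨ε, hε, hball⟩ := Metric.mem_nhds_iff.1 (mem_interior_iff_mem_nhds.1 hy)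
  have huS : (y : E) ∈ S := intrinsicInterior_subset hu
  refine ⟨y, huS, fun t ht c hc => ?_⟩
  have hcl : IsClosed (affineSpan ℝ S : Set E) := AffineSubspace.closed_of_finiteDimensional _
  have htA : t ∈ affineSpan ℝ S := closure_minimal (subset_affineSpan ℝ S) hcl ht
  rcases hc.2.eq_or_lt with rfl | hc1
  · simpa using huS
  have hr : 0 < (1 - c) / c := div_pos (by linarith) hc.1
  obtain ⟨t', ht', hd⟩ := Metric.mem_closure_iff.1 ht (ε / ((1 - c) / c)) (by positivity)
  -- Replacing `t` by a nearby `t'` in `S` is compensated by this shift of the relative interior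
  -- point: the combination with weights `c` and `1 - c` is unchanged.
  have hmem : (y : E) + ((1 - c) / c) • (t - t') ∈ affineSpan ℝ S := by
    have := AffineSubspace.smul_vsub_vadd_mem (affineSpan ℝ S) ((1 - c) / c) htA
      (subset_affineSpan ℝ S ht') y.2
    simpa [add_comm] using this
  have hu' : (y : E) + ((1 - c) / c) • (t - t') ∈ S := by
    have : (⟨_, hmem⟩ : affineSpan ℝ S) ∈ Metric.ball y ε := by
      rw [Metric.mem_ball, Subtype.dist_eq]
      simp only [dist_self_add_left, norm_smul, Real.norm_eq_abs, abs_of_pos hr]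
      rw [dist_eq_norm] at hd
      rw [lt_div_iff₀ hr] at hd
      linarith
    exact hball this
  have := hS hu' ht' hc.1.le (by linarith : 0 ≤ 1 - c) (by ring)
  convert this using 1
  have h1 : c * ((1 - c) / c) = 1 - c := by field_simp [hc.1.ne']
  rw [smul_add, smul_smul, h1]
  module

/-- A convex set without rays contains a translate of its drift. -/
theorem NoRay.exists_add_drift_mem {S : Set E} (h : NoRay S) (hS : Convex ℝ S)
    (hne : S.Nonempty) : ∃ u ∈ S, ∀ w ∈ drift S, u + w ∈ S := by
  obtain ⟨u, hu, hcore⟩ := exists_core_point hS hne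
  refine ⟨u, hu, ?_⟩
  -- `U` collects the directions of full lines through `u` inside `S`. The drift lies in `U` once
  -- every functional killing `U` is known to be bounded on `S`.
  let U : Submodule ℝ E :=
    { carrier := {w | ∀ x : ℝ, u + x • w ∈ S}
      zero_mem' := by simpa using hu
      add_mem' := by
        intro a b ha hb x
        convert hS (ha (2 * x)) (hb (2 * x)) (by norm_num : (0:ℝ) ≤ 1 / 2)
          (by norm_num : (0:ℝ) ≤ 1 / 2) (by norm_num) using 1
        module
      smul_mem' := by
        intro c a ha x
        have := ha (x * c)
        rwa [mul_smul] at this }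
  suffices hsub : ∀ f : Module.Dual ℝ E, (∀ w ∈ U, f w = 0) → f ∈ bddDual S by
    intro w hw
    have hwU : w ∈ U := by
      by_contra hwU
      obtain ⟨φ, h1, h2⟩ := exists_dual_ne_zero hwU
      exact h2 (mem_drift.1 hw φ (hsub φ h1))
    simpa using hwU 1
  obtain ⟨W, hW⟩ := U.exists_isCompl
  let P := W.projection U hW.symm
  have hPW : ∀ x, P x ∈ W := Submodule.projection_apply_mem hW.symm
  have hdiff : ∀ x, x - P x ∈ U := by
    intro x
    rw [← Submodule.projection_apply_eq_zero_iff hW.symm]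
    change P (x - P x) = 0
    rw [map_sub, sub_eq_zero]
    exact (Submodule.projection_apply_of_mem_left hW.symm (hPW x)).symm
  -- The point `t + w` is the limit of combinations of `t` with the far point `u + (n + 1) • w`,
  -- taken with weight `1 / (n + 1)`.
  have hclU : ∀ t ∈ closure S, ∀ w ∈ U, t + w ∈ closure S := by
    intro t ht w hw
    have hlim : Filter.Tendsto (fun n : ℕ => (1 / ((n : ℝ) + 1)) • u
        + (1 - 1 / ((n : ℝ) + 1)) • t + w) Filter.atTop (nhds ((0:ℝ) • u + (1 - (0:ℝ)) • t + w)) := by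
      have h0 := tendsto_one_div_add_atTop_nhds_zero_nat (𝕜 := ℝ)
      exact ((h0.smul_const u).add ((tendsto_const_nhds.sub h0).smul_const t)).add_const w
    have := (isClosed_closure (s := S)).mem_of_tendsto hlim (Filter.Eventually.of_forall fun n => ?_)
    · simpa using this
    have hn : (0:ℝ) < (n:ℝ) + 1 := by positivity
    have hn1 : 1 / ((n : ℝ) + 1) ≤ 1 := by
      rw [div_le_one hn]; have := n.cast_nonneg (α := ℝ); linarith
    have := hS.closure (subset_closure (hw ((n:ℝ) + 1))) ht
      (by positivity : 0 ≤ 1 / ((n : ℝ) + 1)) (by linarith : 0 ≤ 1 - 1 / ((n : ℝ) + 1)) (by ring)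
    convert this using 1
    rw [smul_add, smul_smul, one_div_mul_cancel hn.ne']
    module
  -- Otherwise the normalized projections of points going to infinity accumulate at a unit vector
  -- `w` of `W`, and `w` turns out to be the direction of a ray. `NoRay` then puts `w` into `U`,
  -- which meets `W` only in zero.
  have hbdd : Bornology.IsBounded (P '' S) := by
    by_contra hunb
    have hex : ∀ n : ℕ, ∃ s ∈ S, (n : ℝ) < ‖P s‖ := by
      intro n
      by_contra! hcon
      refine hunb (isBounded_iff_forall_norm_le.2 ⟨n, ?_⟩)
      rintro _ ⟨s, hs, rfl⟩
      exact hcon s hs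
    choose s hs hsn using hex
    have hpos : ∀ n, 0 < ‖P (s n)‖ := fun n => (Nat.cast_nonneg n).trans_lt (hsn n)
    have hsph : ∀ n, ‖P (s n)‖⁻¹ • P (s n) ∈ Metric.sphere (0 : E) 1 := by
      intro n
      simp [norm_smul, (hpos n).ne']
    obtain ⟨w, hw, k, hk, hlim⟩ := (isCompact_sphere (0 : E) 1).tendsto_subseq hsph
    have hwW : w ∈ W := by
      have hWc : IsClosed (W : Set E) := Submodule.closed_of_finiteDimensional W
      refine hWc.mem_of_tendsto hlim (Filter.Eventually.of_forall fun n => ?_)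
      exact W.smul_mem _ (hPW _)
    have hinv : Filter.Tendsto (fun n => ‖P (s (k n))‖⁻¹) Filter.atTop (nhds 0) := by
      refine tendsto_inv_atTop_zero.comp (Filter.tendsto_atTop_mono (fun n => (hsn (k n)).le) ?_)
      exact tendsto_natCast_atTop_atTop.comp hk.tendsto_atTop
    have hcl : ∀ x : ℝ, 0 < x → u + x • w ∈ closure S := by
      intro x hx
      have hl : Filter.Tendsto (fun n => (1 - x * ‖P (s (k n))‖⁻¹) • u
          + x • (‖P (s (k n))‖⁻¹ • P (s (k n)))) Filter.atTop
          (nhds ((1 - x * 0) • u + x • w)) :=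
        ((tendsto_const_nhds.sub (hinv.const_mul x)).smul_const u).add (hlim.const_smul x)
      have hev : ∀ᶠ n in Filter.atTop, x * ‖P (s (k n))‖⁻¹ < 1 := by
        have := hinv.const_mul x
        rw [mul_zero] at this
        exact this.eventually_lt_const one_pos
      have := (isClosed_closure (s := S)).mem_of_tendsto hl (hev.mono fun n hn => ?_)
      · simpa using this
      have hP : P (s (k n)) ∈ closure S := by
        have := hclU _ (subset_closure (hs (k n))) _ (U.neg_mem (hdiff (s (k n))))
        rwa [← sub_eq_add_neg, sub_sub_cancel] at this
      have := hS.closure (subset_closure hu) hP (by linarith : 0 ≤ 1 - x * ‖P (s (k n))‖⁻¹)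
        (by have := hpos (k n); positivity : 0 ≤ x * ‖P (s (k n))‖⁻¹) (by ring)
      rwa [mul_smul x] at this
    -- The midpoint of `u` and the closure point `u + 2x • w` lies in `S` by the choice of `u`.
    have hray : ∀ x : ℝ, 0 < x → u + x • w ∈ S := by
      intro x hx
      have := hcore _ (hcl (2 * x) (by positivity)) (1 / 2) (by constructor <;> norm_num)
      convert this using 1
      module
    have hwU : w ∈ U := h u w hray
    have hw0 : w = 0 := by
      have := hW.disjoint.le_bot ⟨hwU, hwW⟩
      simpa using this
    simp [hw0] at hw
  intro f hf
  have hfP : f = f ∘ₗ P := by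
    ext x
    have := hf _ (hdiff x)
    rw [map_sub, sub_eq_zero] at this
    simpa using this
  rw [hfP]
  exact mem_bddDual_image.1 (mem_bddDual_of_isBounded hbdd f)

/-- Cutting `S` down to the preimage `A` of the line carrying the ray puts `w` into the drift of the
image. It lifts to the drift of `S ∩ A`, a translate of which lies in `S ∩ A`; moving along the lift
sweeps out the whole line. The cut ensures that the translate starts over a point of that line. -/
theorem NoRay.image {S : Set E} (h : NoRay S) (hS : Convex ℝ S) (f : E →ₗ[ℝ] F) :
    NoRay (f '' S) := by
  intro v w hvw x
  let g : ℝ →ᵃ[ℝ] F := AffineMap.lineMap v (v + w)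
  have hg : ∀ y, g y = v + y • w := fun y => by simp [g, AffineMap.lineMap_apply, add_comm]
  let A : AffineSubspace ℝ E := ((⊤ : AffineSubspace ℝ ℝ).map g).comap f.toAffineMap
  have hA : ∀ e, e ∈ A ↔ ∃ y : ℝ, v + y • w = f e := by
    intro e
    simp [A, AffineSubspace.mem_comap, AffineSubspace.mem_map, hg]
  have hAray : NoRay (A : Set E) := by
    intro a b hab y
    have h1 := hab 1 one_pos
    have h2 := hab 2 two_pos
    have := AffineSubspace.smul_vsub_vadd_mem A (y - 1) h2 h1 h1
    simp only [vsub_eq_sub, vadd_eq_add] at this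
    have he : (y - 1) • (a + (2 : ℝ) • b - (a + (1 : ℝ) • b)) + (a + (1 : ℝ) • b) = a + y • b := by
      module
    rwa [he] at this
  obtain ⟨e, he, hev⟩ := hvw 1 one_pos
  have hne : (S ∩ A).Nonempty := ⟨e, he, (hA e).2 ⟨1, hev.symm⟩⟩
  obtain ⟨u, hu, hud⟩ := (h.inter hAray).exists_add_drift_mem (hS.inter A.convex) hne
  have hwd : w ∈ drift (f '' (S ∩ A)) := by
    have hvw' : ∀ y : ℝ, 0 < y → v + y • w ∈ f '' (S ∩ A) := by
      intro y hy
      obtain ⟨e', he', hev'⟩ := hvw y hy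
      exact ⟨e', ⟨he', (hA e').2 ⟨y, hev'.symm⟩⟩, hev'⟩
    refine mem_drift.2 fun φ ⟨c, hc⟩ => ?_
    by_contra h0
    have h1 : NoRay {z : ℝ | |z| ≤ c} := by
      have hb : Bornology.IsBounded {z : ℝ | |z| ≤ c} :=
        isBounded_iff_forall_norm_le.2 ⟨c, fun z hz => hz⟩
      have := (driftInvariant_add_submodule hb ⊥).noRay
      simpa using this
    have h2 := h1 (φ v) (φ w) (fun y hy => by simpa using hc _ (hvw' y hy))
      ((|c| + 1 - φ v) / φ w)
    simp only [smul_eq_mul, div_mul_cancel₀ _ h0, mem_ofPred_eq] at h2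
    have h3 := le_abs_self (φ v + (|c| + 1 - φ v))
    have h4 := le_abs_self c
    linarith
  obtain ⟨w', hw', rfl⟩ := exists_drift_lift f hwd
  obtain ⟨y, hy⟩ := (hA u).1 hu.2
  refine ⟨u + (x - y) • w', (hud _ (Submodule.smul_mem _ _ hw')).1, ?_⟩
  rw [map_add, map_smul, ← hy]
  module

/-- The image of `S` is an interval that inherits `NoRay`. Unbounded above, it would contain a ray
and hence all of `ℝ`. -/
theorem NoRay.bddAbove {S : Set E} (h : NoRay S) (hS : Convex ℝ S) (f : Module.Dual ℝ E)
    {c : ℝ} (hc : ∀ s ∈ S, c ≤ f s) : ∃ d, ∀ s ∈ S, f s ≤ d := by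
  rcases S.eq_empty_or_nonempty with rfl | ⟨s₀, hs₀⟩
  · exact ⟨0, by simp⟩
  by_contra! hcon
  have him : Convex ℝ (f '' S) := hS.linear_image f
  have hray : ∀ x : ℝ, 0 < x → f s₀ + x • (1 : ℝ) ∈ f '' S := by
    intro x hx
    obtain ⟨s, hs, hlt⟩ := hcon (f s₀ + x)
    refine him.ordConnected.out ⟨s₀, hs₀, rfl⟩ ⟨s, hs, rfl⟩ ⟨?_, ?_⟩ <;> simp <;> linarith
  obtain ⟨s, hs, hsx⟩ := h.image hS f _ _ hray (c - 1 - f s₀)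
  have := hc s hs
  simp at hsx
  linarith

/-- Proper separation of a point from a nonempty convex set not containing it. -/
theorem exists_proper_separation {S : Set E} (hS : Convex ℝ S) (hne : S.Nonempty) {p : E}
    (hp : p ∉ S) : ∃ f : Module.Dual ℝ E, (∀ s ∈ S, 0 ≤ f (s - p)) ∧ ∃ s ∈ S, 0 < f (s - p) := by
  have hT : Convex ℝ ((fun s => s - p) '' S) := by
    have := hS.translate (-p)
    simpa only [sub_eq_neg_add] using this
  -- Passing to the cone makes strictness automatic: separating `-u` from its closure forces `f` to
  -- be nonnegative on the cone and positive at the core point `u`.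
  let C := ConvexCone.hull ℝ ((fun s => s - p) '' S)
  have hmem : ∀ {x}, x ∈ C ↔ ∃ r : ℝ, 0 < r ∧ ∃ s ∈ S, r • (s - p) = x := by
    intro x
    rw [ConvexCone.mem_hull_of_convex hT]
    simp [mem_smul_set]
  obtain ⟨s₀, hs₀⟩ := hne
  have h0 : (0 : E) ∉ C := by
    intro h
    obtain ⟨r, hr, s, hs, hrs⟩ := hmem.1 h
    have : s - p = 0 := by simpa [hr.ne'] using hrs
    exact hp (sub_eq_zero.1 this ▸ hs)
  obtain ⟨u, hu, hcore⟩ := exists_core_point C.convex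
    ⟨s₀ - p, hmem.2 ⟨1, one_pos, s₀, hs₀, one_smul _ _⟩⟩
  -- Otherwise the midpoint of `u` and `-u`, which is zero, would belong to the cone.
  have hneg : -u ∉ closure (C : Set E) := by
    intro h
    have := hcore _ h (1 / 2) (by constructor <;> norm_num)
    have he : (1 / 2 : ℝ) • u + (1 - 1 / 2 : ℝ) • -u = 0 := by module
    rw [he] at this
    exact h0 this
  obtain ⟨f, a, hfu, hfC⟩ := geometric_hahn_banach_point_closed C.convex.closure isClosed_closure hneg
  have hnn : ∀ x ∈ C, 0 ≤ f x := by
    intro x hx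
    by_contra! hlt
    have := hfC _ (subset_closure (C.smul_mem (c := (|a| + 1) / (-f x)) (by
      have := neg_pos.2 hlt; positivity) hx))
    rw [map_smul, smul_eq_mul, div_mul_eq_mul_div, lt_div_iff₀ (neg_pos.2 hlt)] at this
    nlinarith [neg_abs_le a]
  have hclos : (0 : E) ∈ closure (C : Set E) := by
    have hl : Filter.Tendsto (fun n : ℕ => (1 / ((n : ℝ) + 1)) • u) Filter.atTop (nhds ((0:ℝ) • u)) :=
      (tendsto_one_div_add_atTop_nhds_zero_nat (𝕜 := ℝ)).smul_const u
    rw [zero_smul] at hl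
    refine isClosed_closure.mem_of_tendsto hl (Filter.Eventually.of_forall fun n => ?_)
    exact subset_closure (C.smul_mem (by positivity) hu)
  have ha : a < 0 := by simpa using hfC 0 hclos
  have hfu' : 0 < f u := by
    rw [map_neg] at hfu
    linarith
  refine ⟨f, fun s hs => hnn _ (hmem.2 ⟨1, one_pos, s, hs, one_smul _ _⟩), ?_⟩
  obtain ⟨r, hr, s, hs, rfl⟩ := hmem.1 hu
  refine ⟨s, hs, ?_⟩
  rw [map_smul, smul_eq_mul] at hfu'
  exact pos_of_mul_pos_right hfu' hr.le

end Normed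

end Geometry

/-! ### Definability, semantically -/

section Definability

open Set FirstOrder

/-- A collection of sets closed under the operations corresponding to the formation rules of
infinitary pp-formulas over the reals with addition, scalar multiplications and constants. -/
structure PPClosed (C : ∀ m : ℕ, Set (Fin m → ℝ) → Prop) : Prop where
  empty : ∀ m, C m ∅
  point : C 1 point
  preimage : ∀ {m n : ℕ} (g : (Fin m → ℝ) →ᵃ[ℝ] (Fin n → ℝ)) {T : Set (Fin n → ℝ)},
    C n T → C m (g ⁻¹' T)
  iInter : ∀ {m : ℕ} {ι : Type} {T : ι → Set (Fin m → ℝ)}, (∀ i, C m (T i)) → C m (⋂ i, T i)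
  proj : ∀ {m : ℕ} {T : Set (Fin (m + 1) → ℝ)}, C (m + 1) T →
    C m {x | ∃ a : ℝ, Fin.snoc (α := fun _ => ℝ) x a ∈ T}

/-- Only the projection rule is assumed, so that the lemma can serve in proving that `IPPDefinable`
is closed under affine preimages. -/
theorem exists_append_of_proj {C : ∀ m : ℕ, Set (Fin m → ℝ) → Prop}
    (hC : ∀ {m : ℕ} {T : Set (Fin (m + 1) → ℝ)}, C (m + 1) T →
      C m {x | ∃ a : ℝ, Fin.snoc (α := fun _ => ℝ) x a ∈ T})
    {m : ℕ} (k : ℕ) {T : Set (Fin (m + k) → ℝ)} (hT : C (m + k) T) :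
    C m {x | ∃ y : Fin k → ℝ, Fin.append x y ∈ T} := by
  induction k with
  | zero =>
    have h : {x : Fin m → ℝ | ∃ y : Fin 0 → ℝ, Fin.append x y ∈ T} = T := by
      ext x
      constructor
      · rintro ⟨y, hy⟩
        rw [Subsingleton.elim y Fin.elim0, Fin.append_elim0] at hy
        exact hy
      · intro hx
        refine ⟨Fin.elim0, ?_⟩
        rw [Fin.append_elim0]
        exact hx
    rw [h]
    exact hT
  | succ k ih =>
    convert ih (hC hT) using 1
    ext x
    constructor
    · rintro ⟨y, hy⟩
      refine ⟨Fin.init y, y (Fin.last k), ?_⟩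
      rw [← Fin.append_snoc, Fin.snoc_init_self]
      exact hy
    · rintro ⟨y, a, hy⟩
      refine ⟨Fin.snoc (α := fun _ => ℝ) y a, ?_⟩
      rw [Fin.append_snoc]
      exact hy

/-! ### Formulas define the least pp-closed collection -/

section Formulas

variable {τ : Set RealRel} {m : ℕ}

/-- With `exists_affineMap_eq_realize`, this identifies the functions given by terms with the affine
functions. -/
theorem exists_term_realize_eq (g : (Fin m → ℝ) →ᵃ[ℝ] ℝ) :
    ∃ t : (lang τ).Term (Fin m), ∀ x : Fin m → ℝ, t.realize x = g x := by
  have hconst : ∀ c : ℝ, ∃ t : (lang τ).Term (Fin m), ∀ x : Fin m → ℝ, t.realize x = c :=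
    fun c => ⟨.func (AffineFunction.const c : (lang τ).Functions 0) Fin.elim0, fun x => rfl⟩
  have hadd : ∀ t₁ t₂ : (lang τ).Term (Fin m), ∃ t : (lang τ).Term (Fin m),
      ∀ x : Fin m → ℝ, t.realize x = t₁.realize x + t₂.realize x :=
    fun t₁ t₂ => ⟨.func (AffineFunction.add : (lang τ).Functions 2) ![t₁, t₂], fun x => rfl⟩
  have hsmul : ∀ (c : ℝ) (t₁ : (lang τ).Term (Fin m)), ∃ t : (lang τ).Term (Fin m),
      ∀ x : Fin m → ℝ, t.realize x = c * t₁.realize x :=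
    fun c t₁ => ⟨.func (AffineFunction.smul c : (lang τ).Functions 1) ![t₁], fun x => rfl⟩
  have hsum : ∀ s : Finset (Fin m), ∃ t : (lang τ).Term (Fin m), ∀ x : Fin m → ℝ,
      t.realize x = ∑ i ∈ s, g.linear (Pi.single i 1) * x i := by
    intro s
    induction s using Finset.induction_on with
    | empty => simpa using hconst 0
    | insert i s hi ih =>
      obtain ⟨t, ht⟩ := ih
      obtain ⟨t', ht'⟩ := hsmul (g.linear (Pi.single i 1)) (.var i)
      obtain ⟨t'', h''⟩ := hadd t' t
      refine ⟨t'', fun x => ?_⟩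
      rw [h'', ht, ht', Finset.sum_insert hi]
      rfl
  obtain ⟨t, ht⟩ := hsum Finset.univ
  obtain ⟨t', ht'⟩ := hconst (g 0)
  obtain ⟨t'', h''⟩ := hadd t' t
  refine ⟨t'', fun x => ?_⟩
  have h1 : g x = g 0 + g.linear x := by simpa using affineMap_add_apply g 0 x
  have h2 : g.linear x = ∑ i, g.linear (Pi.single i 1) * x i := by
    conv_lhs => rw [← LinearMap.sum_single_apply (fun _ => ℝ) x]
    rw [map_sum]
    refine Finset.sum_congr rfl fun i _ => ?_
    have : (Pi.single i (x i) : Fin m → ℝ) = x i • Pi.single i (1 : ℝ) := by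
      rw [← Pi.single_smul, smul_eq_mul, mul_one]
    rw [this, map_smul, smul_eq_mul, mul_comm]
  rw [h'', ht, ht', h1, h2]

theorem exists_affineMap_eq_realize (t : (lang τ).Term (Fin m)) :
    ∃ g : (Fin m → ℝ) →ᵃ[ℝ] ℝ, ∀ x : Fin m → ℝ, t.realize x = g x := by
  induction t with
  | var i => exact ⟨(LinearMap.proj i : (Fin m → ℝ) →ₗ[ℝ] ℝ).toAffineMap, fun x => rfl⟩
  | func f ts ih =>
    choose g hg using ih
    change AffineFunction _ at f
    cases f with
    | const c => exact ⟨AffineMap.const ℝ _ c, fun x => rfl⟩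
    | smul c => exact ⟨c • g 0, fun x => congrArg (c * ·) (hg 0 x)⟩
    | add => exact ⟨g 0 + g 1, fun x => congrArg₂ (· + ·) (hg 0 x) (hg 1 x)⟩

theorem IPPDefinable.rel {T : Set (Fin m → ℝ)} (hT : (⟨m, T⟩ : RealRel) ∈ τ) :
    IPPDefinable τ T :=
  ⟨.rel (⟨T, hT⟩ : (lang τ).Relations m) .var, fun _ => Iff.rfl⟩

theorem IPPDefinable.rename {n : ℕ} {T : Set (Fin n → ℝ)} (hT : IPPDefinable τ T)
    (f : Fin n → Fin m) : IPPDefinable τ {x : Fin m → ℝ | x ∘ f ∈ T} := by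
  obtain ⟨φ, hφ⟩ := hT
  exact ⟨.rename f φ, fun x => hφ _⟩

theorem IPPDefinable.iInter {ι : Type} {T : ι → Set (Fin m → ℝ)}
    (hT : ∀ i, IPPDefinable τ (T i)) : IPPDefinable τ (⋂ i, T i) := by
  choose φ hφ using hT
  exact ⟨.conj φ, fun x => mem_iInter.trans (forall_congr' fun i => hφ i x)⟩

theorem IPPDefinable.proj {T : Set (Fin (m + 1) → ℝ)} (hT : IPPDefinable τ T) :
    IPPDefinable τ {x | ∃ a : ℝ, Fin.snoc (α := fun _ => ℝ) x a ∈ T} := by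
  obtain ⟨φ, hφ⟩ := hT
  exact ⟨.ex φ, fun x => exists_congr fun a => hφ _⟩

theorem IPPDefinable.eqLocus (g₁ g₂ : (Fin m → ℝ) →ᵃ[ℝ] ℝ) :
    IPPDefinable τ {x | g₁ x = g₂ x} := by
  obtain ⟨t₁, h₁⟩ := exists_term_realize_eq (τ := τ) g₁
  obtain ⟨t₂, h₂⟩ := exists_term_realize_eq (τ := τ) g₂
  refine ⟨.equal t₁ t₂, fun x => ?_⟩
  change g₁ x = g₂ x ↔ t₁.realize x = t₂.realize x
  rw [h₁, h₂]

/-- Formulas allow substitution of variables only, so the preimage is obtained by projecting the set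
of pairs `(x, y)` with `y = g x` and `y ∈ T`. -/
theorem IPPDefinable.affine_preimage {n : ℕ} (g : (Fin m → ℝ) →ᵃ[ℝ] (Fin n → ℝ))
    {T : Set (Fin n → ℝ)} (hT : IPPDefinable τ T) : IPPDefinable τ (g ⁻¹' T) := by
  let p : (Fin (m + n) → ℝ) →ᵃ[ℝ] (Fin m → ℝ) :=
    (LinearMap.funLeft ℝ ℝ (Fin.castAdd n)).toAffineMap
  let q : Fin n → (Fin (m + n) → ℝ) →ᵃ[ℝ] ℝ := fun i =>
    (LinearMap.proj (Fin.natAdd m i) : (Fin (m + n) → ℝ) →ₗ[ℝ] ℝ).toAffineMap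
  let r : Fin n → (Fin (m + n) → ℝ) →ᵃ[ℝ] ℝ := fun i =>
    ((LinearMap.proj i : (Fin n → ℝ) →ₗ[ℝ] ℝ).toAffineMap.comp g).comp p
  have h1 : IPPDefinable τ (⋂ o : Option (Fin n),
      o.elim {z | z ∘ Fin.natAdd m ∈ T} (fun i => {z | q i z = r i z})) := by
    refine IPPDefinable.iInter fun o => ?_
    cases o with
    | none => exact hT.rename (Fin.natAdd m)
    | some i => exact IPPDefinable.eqLocus _ _
  convert exists_append_of_proj (C := fun m T => IPPDefinable τ T) IPPDefinable.proj n h1 using 1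
  ext x
  have hp : ∀ y : Fin n → ℝ, p (Fin.append x y) = x := by
    intro y
    ext i
    simp [p, LinearMap.funLeft_apply]
  have hy : ∀ y : Fin n → ℝ, Fin.append x y ∘ Fin.natAdd m = y := by
    intro y
    ext i
    simp
  have hq : ∀ (y : Fin n → ℝ) i, q i (Fin.append x y) = y i := by
    intro y i
    simp [q]
  have hr : ∀ (y : Fin n → ℝ) i, r i (Fin.append x y) = g x i := by
    intro y i
    simp only [r, AffineMap.comp_apply, hp]
    rfl
  constructor
  · intro hx
    refine ⟨g x, mem_iInter.2 fun o => ?_⟩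
    cases o with
    | none => change _ ∘ _ ∈ T; rw [hy]; exact hx
    | some i => change q i _ = r i _; rw [hq, hr]
  · rintro ⟨y, h⟩
    have h0 := mem_iInter.1 h none
    change _ ∘ _ ∈ T at h0
    rw [hy] at h0
    have h2 : y = g x := by
      ext i
      have := mem_iInter.1 h (some i)
      change q i _ = r i _ at this
      rwa [hq, hr] at this
    rwa [h2] at h0

theorem IPPDefinable.ppClosed (τ : Set RealRel) : PPClosed fun _ T => IPPDefinable τ T where
  empty _ := ⟨.falsum, fun _ => Iff.rfl⟩
  point := IPPDefinable.eqLocus (LinearMap.proj (0 : Fin 1) : (Fin 1 → ℝ) →ₗ[ℝ] ℝ).toAffineMap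
    (AffineMap.const ℝ _ 0)
  preimage g _ hT := hT.affine_preimage g
  iInter := IPPDefinable.iInter
  proj := IPPDefinable.proj

theorem PPClosed.of_definable {C : ∀ m : ℕ, Set (Fin m → ℝ) → Prop} (hC : PPClosed C)
    (hτ : ∀ R ∈ τ, C R.1 R.2) {T : Set (Fin m → ℝ)} (hT : IPPDefinable τ T) : C m T := by
  obtain ⟨φ, hφ⟩ := hT
  have hTφ : T = {x | φ.Realize x} := ext hφ
  rw [hTφ]
  clear hTφ hφ T
  induction φ with
  | @verum n =>
    have := hC.iInter (m := n) (ι := Empty) (T := Empty.elim) (fun i => i.elim)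
    rwa [iInter_of_empty] at this
  | falsum => exact hC.empty _
  | equal t₁ t₂ =>
    obtain ⟨g₁, h₁⟩ := exists_affineMap_eq_realize t₁
    obtain ⟨g₂, h₂⟩ := exists_affineMap_eq_realize t₂
    convert hC.preimage (AffineMap.pi fun _ => g₁ - g₂) hC.point using 1
    ext x
    change t₁.realize x = t₂.realize x ↔ g₁ x - g₂ x = 0
    rw [h₁, h₂, sub_eq_zero]
  | rel R ts =>
    choose g hg using fun i => exists_affineMap_eq_realize (ts i)
    convert hC.preimage (AffineMap.pi g) (hτ _ R.2) using 1
    ext x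
    change (fun i => (ts i).realize x) ∈ R.1 ↔ (fun i => g i x) ∈ R.1
    simp only [hg]
  | rename f φ ih => exact hC.preimage (LinearMap.funLeft ℝ ℝ f).toAffineMap ih
  | conj φ ih =>
    convert hC.iInter ih using 1
    ext x
    exact mem_iInter.symm
  | ex φ ih => exact hC.proj ih

end Formulas

/-! ### Affine functions -/

section Affine

variable {E F G : Type*} [AddCommGroup E] [Module ℝ E] [AddCommGroup F] [Module ℝ F]
  [AddCommGroup G] [Module ℝ G]

/-- The function `g` is affine. -/
@[fun_prop]
def IsAff (g : E → F) : Prop := ∃ g' : E →ᵃ[ℝ] F, ⇑g' = g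

@[fun_prop]
theorem IsAff.id : IsAff (fun x : E => x) := ⟨AffineMap.id ℝ E, rfl⟩

@[fun_prop]
theorem IsAff.const (c : F) : IsAff (fun _ : E => c) := ⟨AffineMap.const ℝ E c, rfl⟩

@[fun_prop]
theorem IsAff.comp {g : F → G} {f : E → F} (hg : IsAff g) (hf : IsAff f) :
    IsAff (fun x => g (f x)) := by
  obtain ⟨g', rfl⟩ := hg
  obtain ⟨f', rfl⟩ := hf
  exact ⟨g'.comp f', rfl⟩

@[fun_prop]
theorem IsAff.linear (g : E →ₗ[ℝ] F) : IsAff (fun x => g x) := ⟨g.toAffineMap, rfl⟩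

@[fun_prop]
theorem IsAff.add {f g : E → F} (hf : IsAff f) (hg : IsAff g) : IsAff (fun x => f x + g x) := by
  obtain ⟨g', rfl⟩ := hg
  obtain ⟨f', rfl⟩ := hf
  exact ⟨f' + g', rfl⟩

@[fun_prop]
theorem IsAff.sub {f g : E → F} (hf : IsAff f) (hg : IsAff g) : IsAff (fun x => f x - g x) := by
  obtain ⟨g', rfl⟩ := hg
  obtain ⟨f', rfl⟩ := hf
  exact ⟨f' - g', rfl⟩

@[fun_prop]
theorem IsAff.const_smul (c : ℝ) {f : E → F} (hf : IsAff f) : IsAff (fun x => c • f x) := by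
  obtain ⟨f', rfl⟩ := hf
  exact ⟨c • f', rfl⟩

@[fun_prop]
theorem IsAff.smul_const {f : E → ℝ} (hf : IsAff f) (c : F) : IsAff (fun x => f x • c) :=
  (IsAff.linear (LinearMap.toSpanSingleton ℝ F c)).comp hf

@[fun_prop]
theorem IsAff.const_mul (c : ℝ) {f : E → ℝ} (hf : IsAff f) : IsAff (fun x => c * f x) :=
  hf.const_smul c

@[fun_prop]
theorem IsAff.mul_const {f : E → ℝ} (hf : IsAff f) (c : ℝ) : IsAff (fun x => f x * c) :=
  hf.smul_const c

@[fun_prop]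
theorem IsAff.prodMk {f : E → F} {g : E → G} (hf : IsAff f) (hg : IsAff g) :
    IsAff (fun x => (f x, g x)) := by
  obtain ⟨g', rfl⟩ := hg
  obtain ⟨f', rfl⟩ := hf
  exact ⟨f'.prod g', rfl⟩

@[fun_prop]
theorem IsAff.fst {f : E → F × G} (hf : IsAff f) : IsAff (fun x => (f x).1) :=
  (IsAff.linear (LinearMap.fst ℝ F G)).comp hf

@[fun_prop]
theorem IsAff.snd {f : E → F × G} (hf : IsAff f) : IsAff (fun x => (f x).2) :=
  (IsAff.linear (LinearMap.snd ℝ F G)).comp hf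

@[fun_prop]
theorem IsAff.apply {ι : Type*} (i : ι) : IsAff (fun x : ι → ℝ => x i) :=
  IsAff.linear (LinearMap.proj (φ := fun _ : ι => ℝ) i)

@[fun_prop]
theorem IsAff.pi {ι : Type*} {f : E → ι → ℝ} (hf : ∀ i, IsAff (fun x => f x i)) : IsAff f := by
  choose g hg using hf
  exact ⟨AffineMap.pi g, funext fun x => funext fun i => congrFun (hg i) x⟩

end Affine

/-! ### Coordinate-free definability -/

/-- All coordinate representations of `S` belong to the collection `C`. -/
def Def (C : ∀ m : ℕ, Set (Fin m → ℝ) → Prop) {E : Type*} [AddCommGroup E] [Module ℝ E]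
    (S : Set E) : Prop :=
  ∀ (m : ℕ) (g : (Fin m → ℝ) →ᵃ[ℝ] E), C m (g ⁻¹' S)

section Def

variable {C : ∀ m : ℕ, Set (Fin m → ℝ) → Prop} {E F : Type*} [AddCommGroup E] [Module ℝ E]
  [AddCommGroup F] [Module ℝ F]

theorem Def.of (hC : PPClosed C) {n : ℕ} {S : Set (Fin n → ℝ)} (hS : C n S) : Def C S :=
  fun _ g => hC.preimage g hS

theorem Def.out {n : ℕ} {S : Set (Fin n → ℝ)} (hS : Def C S) : C n S :=
  hS n (AffineMap.id ℝ _)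

theorem Def.preimage {S : Set F} (hS : Def C S) {g : E → F} (hg : IsAff g) :
    Def C {x | g x ∈ S} := by
  obtain ⟨g', rfl⟩ := hg
  exact fun m f => hS m (g'.comp f)

theorem Def.empty (hC : PPClosed C) : Def C (∅ : Set E) := fun m _ => hC.empty m

theorem Def.iInter (hC : PPClosed C) {ι : Type} {S : ι → Set E} (hS : ∀ i, Def C (S i)) :
    Def C (⋂ i, S i) := by
  intro m g
  rw [preimage_iInter]
  exact hC.iInter fun i => hS i m g

theorem Def.forall (hC : PPClosed C) {ι : Type} {S : ι → E → Prop}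
    (hS : ∀ i, Def C {x | S i x}) : Def C {x | ∀ i, S i x} := by
  convert Def.iInter hC hS using 1
  ext x
  exact mem_iInter.symm

theorem Def.and (hC : PPClosed C) {S T : E → Prop} (hS : Def C {x | S x}) (hT : Def C {x | T x}) :
    Def C {x | S x ∧ T x} := by
  convert Def.forall hC (S := fun b : Bool => cond b S T)
    (fun b => by cases b; exacts [hT, hS]) using 1
  ext x
  constructor
  · rintro ⟨h1, h2⟩ (_ | _)
    exacts [h2, h1]
  · exact fun h => ⟨h true, h false⟩

theorem Def.zero (hC : PPClosed C) : Def C ({0} : Set ℝ) := by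
  convert (Def.of hC hC.point).preimage (g := fun (x : ℝ) (_ : Fin 1) => x) (by fun_prop) using 1
  ext x
  exact Iff.rfl

theorem Def.exists (hC : PPClosed C) [FiniteDimensional ℝ F] {S : E → F → Prop}
    (hS : Def C {p : E × F | S p.1 p.2}) : Def C {x | ∃ y, S x y} := by
  intro m g
  let e := (Module.finBasis ℝ F).equivFun
  let k := Module.finrank ℝ F
  let p : (Fin (m + k) → ℝ) →ᵃ[ℝ] E × F :=
    (g.comp (LinearMap.funLeft ℝ ℝ (Fin.castAdd k)).toAffineMap).prod
      (e.symm.toLinearMap ∘ₗ LinearMap.funLeft ℝ ℝ (Fin.natAdd m)).toAffineMap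
  have hp : ∀ (x : Fin m → ℝ) (y : Fin k → ℝ), p (Fin.append x y) = (g x, e.symm y) := by
    intro x y
    have h1 : LinearMap.funLeft ℝ ℝ (Fin.castAdd k) (Fin.append x y) = x := by
      ext i; simp [LinearMap.funLeft_apply]
    have h2 : LinearMap.funLeft ℝ ℝ (Fin.natAdd m) (Fin.append x y) = y := by
      ext i; simp [LinearMap.funLeft_apply]
    exact Prod.ext (congrArg g h1) (congrArg e.symm h2)
  convert exists_append_of_proj hC.proj k (hS _ p) using 1
  ext x
  constructor
  · rintro ⟨y, hy⟩
    refine ⟨e y, ?_⟩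
    change p _ ∈ {p : E × F | S p.1 p.2}
    rw [hp]
    simpa using hy
  · rintro ⟨y, hy⟩
    change p _ ∈ {p : E × F | S p.1 p.2} at hy
    rw [hp] at hy
    exact ⟨e.symm y, hy⟩

end Def

end Definability

/-! ### Building convex sets from the representatives -/

section Building

open Set

variable {C : ∀ m : ℕ, Set (Fin m → ℝ) → Prop}

theorem Def.eqLocus (hC : PPClosed C) {E F : Type*} [AddCommGroup E] [Module ℝ E]
    [AddCommGroup F] [Module ℝ F] [FiniteDimensional ℝ F] {f g : E → F}
    (hf : IsAff f) (hg : IsAff g) : Def C {x | f x = g x} := by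
  let e := (Module.finBasis ℝ F).equivFun
  have he : ∀ i, IsAff fun y : F => e y i := fun i =>
    (IsAff.apply i).comp (IsAff.linear e.toLinearMap)
  convert Def.forall hC (S := fun i x => e (f x - g x) i ∈ ({0} : Set ℝ)) (fun i =>
    (Def.zero hC).preimage ((he i).comp (hf.sub hg))) using 1
  ext x
  change f x = g x ↔ ∀ i, e (f x - g x) i = 0
  rw [← sub_eq_zero, ← e.map_eq_zero_iff, funext_iff]
  rfl

theorem Def.of_affineSubspace (hC : PPClosed C) {E : Type*} [AddCommGroup E] [Module ℝ E]
    [FiniteDimensional ℝ E] (A : AffineSubspace ℝ E) : Def C (A : Set E) := by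
  rcases (A : Set E).eq_empty_or_nonempty with h | ⟨p, hp⟩
  · rw [h]
    exact Def.empty hC
  · convert Def.eqLocus hC (f := fun x : E => A.direction.mkQ (x - p)) (g := fun _ => 0)
      ((IsAff.linear _).comp (by fun_prop)) (by fun_prop) using 1
    ext x
    have := AffineSubspace.vsub_right_mem_direction_iff_mem (s := A) hp x
    rw [vsub_eq_sub] at this
    rw [SetLike.mem_coe, ← this]
    exact (Submodule.Quotient.mk_eq_zero _).symm

theorem Def.icc (hC : PPClosed C) (hI : Def C (Icc (0 : ℝ) 1)) (a b : ℝ) : Def C (Icc a b) := by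
  rcases lt_trichotomy a b with h | rfl | h
  · convert hI.preimage (g := fun x : ℝ => (b - a)⁻¹ * (x - a)) (by fun_prop) using 1
    ext x
    have : 0 < b - a := sub_pos.2 h
    change _ ↔ 0 ≤ _ ∧ _ ≤ 1
    rw [inv_mul_le_iff₀ this, mul_nonneg_iff_of_pos_left (by positivity), mem_Icc]
    constructor <;> rintro ⟨h1, h2⟩ <;> constructor <;> linarith
  · rw [Icc_self]
    exact Def.eqLocus hC (f := fun x : ℝ => x) (by fun_prop) (IsAff.const a)
  · rw [Icc_eq_empty h.not_ge]
    exact Def.empty hC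

theorem Def.ioo (hC : PPClosed C) (hO : Def C (Ioo (0 : ℝ) 1)) (a b : ℝ) : Def C (Ioo a b) := by
  rcases lt_or_ge a b with h | h
  · convert hO.preimage (g := fun x : ℝ => (b - a)⁻¹ * (x - a)) (by fun_prop) using 1
    ext x
    have : 0 < b - a := sub_pos.2 h
    change _ ↔ 0 < _ ∧ _ < 1
    rw [inv_mul_lt_iff₀ this, mul_pos_iff_of_pos_left (by positivity), mem_Ioo]
    constructor <;> rintro ⟨h1, h2⟩ <;> constructor <;> linarith
  · rw [Ioo_eq_empty h.not_gt]
    exact Def.empty hC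

/-- The closed interval is the intersection of its open neighbourhoods, which takes an infinite
conjunction. -/
theorem Def.icc_of_ioo (hC : PPClosed C) (hO : Def C (Ioo (0 : ℝ) 1)) : Def C (Icc (0 : ℝ) 1) := by
  convert Def.forall hC (S := fun (ε : {ε : ℝ // 0 < ε}) x => x ∈ Ioo (-ε : ℝ) (1 + ε))
    (fun ε => Def.ioo hC hO _ _) using 1
  ext x
  constructor
  · rintro ⟨h1, h2⟩ ⟨ε, hε⟩
    constructor <;> simp only <;> linarith
  · intro h
    constructor
    · exact le_of_forall_pos_lt_add fun ε hε => by have := (h ⟨ε, hε⟩).1; simp only at this; linarith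
    · exact le_of_forall_pos_lt_add fun ε hε => (h ⟨ε, hε⟩).2

theorem Def.ico (hC : PPClosed C) (hO : Def C (Ioo (0 : ℝ) 1)) (a b : ℝ) : Def C (Ico a b) := by
  convert Def.and hC (Def.icc hC (Def.icc_of_ioo hC hO) a b) (Def.ioo hC hO (a - 1) b) using 1
  ext x
  change a ≤ x ∧ x < b ↔ (a ≤ x ∧ x ≤ b) ∧ (a - 1 < x ∧ x < b)
  constructor
  · rintro ⟨h1, h2⟩
    exact ⟨⟨h1, h2.le⟩, by linarith, h2⟩
  · rintro ⟨⟨h1, _⟩, _, h2⟩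
    exact ⟨h1, h2⟩

/-! ### Minimal faces of convex sets -/

section Basic

variable {E : Type*} [NormedAddCommGroup E] [NormedSpace ℝ E]

theorem isCompact_convexJoin {s t : Set E} (hs : IsCompact s) (ht : IsCompact t) :
    IsCompact (convexJoin ℝ s t) := by
  have h : convexJoin ℝ s t = (fun q : ℝ × E × E => (1 - q.1) • q.2.1 + q.1 • q.2.2) ''
      (Icc (0 : ℝ) 1 ×ˢ s ×ˢ t) := by
    ext x
    simp only [mem_convexJoin, segment_eq_image, mem_image, Prod.exists, mem_prod]
    constructor
    · rintro ⟨a, ha, b, hb, θ, hθ, rfl⟩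
      exact ⟨θ, a, b, ⟨hθ, ha, hb⟩, rfl⟩
    · rintro ⟨θ, a, b, ⟨hθ, ha, hb⟩, rfl⟩
      exact ⟨a, ha, b, hb, θ, hθ, rfl⟩
  rw [h]
  exact (isCompact_Icc.prod (hs.prod ht)).image (by fun_prop)

theorem NoRay.singleton (c : E) : NoRay ({c} : Set E) := by
  intro v w hvw x
  have h1 : v + (1 : ℝ) • w = c := hvw 1 one_pos
  have h2 : v + (2 : ℝ) • w = c := hvw 2 two_pos
  have hw : w = 0 := by
    have : w = (v + (2 : ℝ) • w) - (v + (1 : ℝ) • w) := by module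
    rw [this, h1, h2, sub_self]
  subst hw
  simpa using h1

theorem convex_fixed (P : E →ₗ[ℝ] E) : Convex ℝ {x | P x = x} := by
  intro x hx y hy a b _ _ _
  change P x = x at hx
  change P y = y at hy
  change P _ = _
  rw [map_add, map_smul, map_smul, hx, hy]

/-- The directions along which `p` is an interior point of the convex set `K`. -/
def facialDirections (K : Set E) (hK : Convex ℝ K) (p : E) (hp : p ∈ K) : Submodule ℝ E where
  carrier := {v | ∃ δ : ℝ, 0 < δ ∧ p + δ • v ∈ K ∧ p - δ • v ∈ K}
  zero_mem' := ⟨1, one_pos, by simpa using hp, by simpa using hp⟩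
  add_mem' := by
    rintro a b ⟨δ, hδ, h1, h2⟩ ⟨ε, hε, h3, h4⟩
    -- The weights `ε / (δ + ε)` and `δ / (δ + ε)` give `a` and `b` the same coefficient.
    have hs : 0 < δ + ε := by positivity
    have hα : 0 ≤ ε / (δ + ε) := by positivity
    have hβ : 0 ≤ δ / (δ + ε) := by positivity
    have hαβ : ε / (δ + ε) + δ / (δ + ε) = 1 := by field_simp; ring
    have e1 : (ε / (δ + ε)) * δ = δ * ε / (δ + ε) := by ring
    have e2 : (δ / (δ + ε)) * ε = δ * ε / (δ + ε) := by ring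
    refine ⟨δ * ε / (δ + ε), by positivity, ?_, ?_⟩
    · have := hK h1 h3 hα hβ hαβ
      rw [smul_add, smul_add, smul_smul, smul_smul, e1, e2, add_add_add_comm, ← add_smul, hαβ,
        one_smul, ← smul_add] at this
      exact this
    · have := hK h2 h4 hα hβ hαβ
      rw [smul_sub, smul_sub, smul_smul, smul_smul, e1, e2, sub_add_sub_comm, ← add_smul, hαβ,
        one_smul, ← smul_add] at this
      exact this
  smul_mem' := by
    rintro c a ⟨δ, hδ, h1, h2⟩
    rcases lt_trichotomy c 0 with h | rfl | h
    · refine ⟨δ / -c, div_pos hδ (neg_pos.2 h), ?_, ?_⟩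
      · have e : (δ / -c) • c • a = -(δ • a) := by
          rw [smul_smul, ← neg_smul]; congr 1; rw [div_neg, neg_mul, div_mul_cancel₀ _ h.ne]
        rwa [e, ← sub_eq_add_neg]
      · have e : (δ / -c) • c • a = -(δ • a) := by
          rw [smul_smul, ← neg_smul]; congr 1; rw [div_neg, neg_mul, div_mul_cancel₀ _ h.ne]
        rwa [e, sub_neg_eq_add]
    · exact ⟨1, one_pos, by simpa using hp, by simpa using hp⟩
    · have e : (δ / c) • c • a = δ • a := by
        rw [smul_smul]; congr 1; field_simp
      exact ⟨δ / c, div_pos hδ h, by rwa [e], by rwa [e]⟩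

theorem mem_facialDirections {K : Set E} {hK : Convex ℝ K} {p : E} {hp : p ∈ K} {x : E}
    (hx : x ∈ K) : x - p ∈ facialDirections K hK p hp ↔ ∃ δ : ℝ, 0 < δ ∧ p - δ • (x - p) ∈ K := by
  constructor
  · rintro ⟨δ, hδ, -, h⟩
    exact ⟨δ, hδ, h⟩
  · rintro ⟨δ, hδ, h⟩
    refine ⟨min δ 1, by positivity, ?_, ?_⟩
    · have := hK hp hx (sub_nonneg.2 (min_le_right δ 1)) (by positivity : 0 ≤ min δ 1) (by ring)
      convert this using 1
      module
    · have h1 : min δ 1 / δ ≤ 1 := (div_le_one hδ).2 (min_le_left _ _)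
      have := hK hp h (sub_nonneg.2 h1) (by positivity : 0 ≤ min δ 1 / δ) (by ring)
      convert this using 1
      have e : (min δ 1 / δ) * δ = min δ 1 := div_mul_cancel₀ _ hδ.ne'
      nth_rewrite 1 [← e]
      module

/-- The face property: prolong the segment from `a • x + b • y` beyond `p` to a point of `K`, then
mix in just enough of `y` to cancel its contribution. The result is a prolongation from `x` beyond
`p`. -/
theorem facialDirections_face {K : Set E} {hK : Convex ℝ K} {p : E} {hp : p ∈ K} {x y : E}
    (hx : x ∈ K) (hy : y ∈ K) {a b : ℝ} (ha : 0 < a) (hb : 0 < b) (hab : a + b = 1)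
    (h : a • x + b • y - p ∈ facialDirections K hK p hp) :
    x - p ∈ facialDirections K hK p hp := by
  obtain ⟨δ, hδ, -, hq⟩ := h
  rw [mem_facialDirections hx]
  have h1 : 0 < 1 + δ * b := by positivity
  refine ⟨δ * a / (1 + δ * b), by positivity, ?_⟩
  have := hK hq hy (by positivity : 0 ≤ 1 / (1 + δ * b)) (by positivity : 0 ≤ δ * b / (1 + δ * b))
    (by field_simp)
  convert this using 1
  have e1 : δ * b / (1 + δ * b) = (1 / (1 + δ * b)) * (δ * b) := by ring
  have e2 : δ * a / (1 + δ * b) = (1 / (1 + δ * b)) * (δ * a) := by ring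
  have e3 : p = (1 / (1 + δ * b)) • ((1 + δ * b) • p) := by
    rw [smul_smul, one_div_mul_cancel h1.ne', one_smul]
  rw [e1, e2, mul_smul _ (δ * b), mul_smul _ (δ * a), ← smul_add]
  nth_rewrite 1 [e3]
  rw [← smul_sub]
  congr 1
  obtain rfl : b = 1 - a := by linarith
  module

end Basic

/-! ### Sets definable from closed and open intervals -/

section Closed

variable {E : Type} [NormedAddCommGroup E] [NormedSpace ℝ E] [FiniteDimensional ℝ E]

/-- A separating functional is bounded below on `S`, hence also above by `NoRay`, so slabs can
replace the half-spaces of the dual description. -/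
theorem Def.of_isClosed (hC : PPClosed C) (hI : Def C (Icc (0 : ℝ) 1)) {S : Set E}
    (hS : Convex ℝ S) (hcl : IsClosed S) (hray : NoRay S) : Def C S := by
  convert Def.forall hC
    (S := fun (q : {q : Module.Dual ℝ E × ℝ × ℝ // ∀ s ∈ S, q.1 s ∈ Icc q.2.1 q.2.2}) x =>
      q.1.1 x ∈ Icc q.1.2.1 q.1.2.2)
    (fun q => (Def.icc hC hI _ _).preimage (IsAff.linear q.1.1)) using 1
  ext x
  refine ⟨fun hx q => q.2 x hx, fun h => ?_⟩
  by_contra hx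
  obtain ⟨f, u, hfx, hfS⟩ := geometric_hahn_banach_point_closed hS hcl hx
  obtain ⟨d, hd⟩ := hray.bddAbove hS f.toLinearMap (c := u) fun s hs => (hfS s hs).le
  have := h ⟨(f.toLinearMap, u, d), fun s hs => ⟨(hfS s hs).le, hd s hs⟩⟩
  exact absurd this.1 (not_le.2 hfx)

theorem isCompact_convexHull {K : Set E} (hK : IsCompact K) : IsCompact (convexHull ℝ K) := by
  let J : ℕ → Set E := fun n => (fun T => convexJoin ℝ K T)^[n] K
  have hJs : ∀ n, J (n + 1) = convexJoin ℝ K (J n) := fun n =>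
    Function.iterate_succ_apply' _ n K
  have hJ : ∀ n, IsCompact (J n) := by
    intro n
    induction n with
    | zero => exact hK
    | succ n ih => rw [hJs]; exact isCompact_convexJoin hK ih
  have hJsub : ∀ n, J n ⊆ convexHull ℝ K := by
    intro n
    induction n with
    | zero => exact subset_convexHull ℝ K
    | succ n ih =>
      rw [hJs]
      exact convexJoin_subset (subset_convexHull ℝ K) ih (convex_convexHull ℝ K)
  -- By Carathéodory, hulls of at most `finrank + 1` points suffice; `J n` takes care of `n + 1`
  -- points.
  have hfin : ∀ n, ∀ t : Finset E, (t : Set E) ⊆ K → t.card = n + 1 →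
      convexHull ℝ (t : Set E) ⊆ J n := by
    intro n
    induction n with
    | zero =>
      intro t ht hc
      obtain ⟨a, rfl⟩ := Finset.card_eq_one.1 hc
      rw [Finset.coe_singleton, convexHull_singleton]
      rwa [Finset.coe_singleton] at ht
    | succ n ih =>
      intro t ht hc
      classical
      obtain ⟨a, t', ha, rfl, hc'⟩ := Finset.card_eq_succ.1 hc
      have hne : (t' : Set E).Nonempty := by
        rw [Finset.coe_nonempty, ← Finset.card_pos]; omega
      rw [Finset.coe_insert, convexHull_insert hne, hJs]
      rw [Finset.coe_insert, insert_subset_iff] at ht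
      exact convexJoin_mono (singleton_subset_iff.2 ht.1) (ih t' ht.2 hc')
  have heq : convexHull ℝ K = ⋃ n ∈ Finset.range (Module.finrank ℝ E + 1), J n := by
    apply Subset.antisymm
    · intro x hx
      rw [convexHull_eq_union] at hx
      simp only [mem_iUnion] at hx
      obtain ⟨t, htK, hind, hxt⟩ := hx
      have hcard := hind.card_le_finrank_succ
      rw [Fintype.card_coe] at hcard
      have hfr := Submodule.finrank_le (vectorSpan ℝ (range ((↑) : t → E)))
      have hpos : 0 < t.card := by
        rw [Finset.card_pos, ← Finset.coe_nonempty, ← convexHull_nonempty_iff (𝕜 := ℝ)]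
        exact ⟨x, hxt⟩
      refine mem_biUnion (x := t.card - 1) ?_ (hfin _ t htK (by omega) hxt)
      simp
      omega
    · exact iUnion₂_subset fun n _ => hJsub n
  rw [heq]
  exact (Finset.range _).isCompact_biUnion fun n _ => hJ n

theorem Def.of_bounded_noSemident (hC : PPClosed C) (hO : Def C (Ioo (0 : ℝ) 1)) {S : Set E}
    (hS : Convex ℝ S) (hb : Bornology.IsBounded S) (hsd : NoSemident S) : Def C S := by
  have hI := Def.icc_of_ioo hC hO
  have hcompact : ∀ {F : Type} [NormedAddCommGroup F] [NormedSpace ℝ F] [FiniteDimensional ℝ F]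
      {K : Set F}, Convex ℝ K → IsCompact K → Def C K := by
    intro F _ _ _ K hK hKc
    refine Def.of_isClosed hC hI hK hKc.isClosed ?_
    have := (driftInvariant_add_submodule hKc.isBounded ⊥).noRay
    simpa using this
  have hK : Convex ℝ (closure S) := hS.closure
  have hKc : IsCompact (closure S) := hb.isCompact_closure
  suffices hsep : ∀ p ∈ closure S, p ∉ S → ∃ M : Set E, Def C M ∧ S ⊆ M ∧ p ∉ M by
    choose! M hM hSM hpM using hsep
    convert Def.and hC (hcompact hK hKc) (Def.forall hC (S := fun (p : ↥(closure S \ S)) x => x ∈ M p)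
      (fun p => hM p p.2.1 p.2.2)) using 1
    ext x
    constructor
    · exact fun hx => ⟨subset_closure hx, fun p => hSM p p.2.1 p.2.2 hx⟩
    · rintro ⟨hx, hall⟩
      by_contra hxS
      exact hpM x hx hxS (hall ⟨x, hx, hxS⟩)
  intro p hp hpS
  let D := facialDirections (closure S) hK p hp
  -- The distance to `p + D` vanishes on `closure S` exactly on the minimal face containing `p`.
  -- That face contains no point of `S`, as `p` would then be a semident.
  let g : E → ℝ := fun x => Metric.infDist (x - p) (D : Set E)
  have hg : Continuous g := (Metric.continuous_infDist_pt _).comp (by fun_prop)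
  have hg0 : ∀ x, g x = 0 ↔ x - p ∈ D := by
    intro x
    have hDc : IsClosed (D : Set E) := Submodule.closed_of_finiteDimensional D
    exact (hDc.mem_iff_infDist_zero ⟨0, D.zero_mem⟩).symm
  let G : Set (E × ℝ) := (fun x => (x, g x)) '' closure S
  have hGc : IsCompact (convexHull ℝ G) := isCompact_convexHull (hKc.image (by fun_prop))
  obtain ⟨c, hc⟩ := hGc.isBounded.exists_norm_le
  -- Positive height in the hull of the graph of `g` is the separating condition. The bound `c + 1`
  -- exceeds all heights and merely allows the use of an open interval.
  refine ⟨{x | ∃ z : ℝ, (x, z) ∈ convexHull ℝ G ∧ z ∈ Ioo 0 (c + 1)}, ?_, ?_, ?_⟩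
  · exact Def.exists hC (Def.and hC (hcompact (convex_convexHull ℝ G) hGc)
      ((Def.ioo hC hO _ _).preimage (g := fun q : E × ℝ => q.2) (by fun_prop)))
  · intro x hx
    have hmem : (x, g x) ∈ convexHull ℝ G :=
      subset_convexHull ℝ G ⟨x, subset_closure hx, rfl⟩
    refine ⟨g x, hmem, ?_, ?_⟩
    · refine lt_of_le_of_ne Metric.infDist_nonneg fun h => ?_
      obtain ⟨δ, hδ, hq⟩ := (mem_facialDirections (subset_closure hx)).1 ((hg0 x).1 h.symm)
      have h1 : 0 < 1 + δ := by positivity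
      have := hsd x hx _ hq (δ / (1 + δ)) ⟨by positivity, by rw [div_lt_one h1]; linarith⟩
      refine hpS ?_
      convert this using 1
      have e1 : 1 - δ / (1 + δ) = 1 / (1 + δ) := by field_simp; ring
      have e2 : δ / (1 + δ) = (1 / (1 + δ)) * δ := by ring
      have e3 : p = (1 / (1 + δ)) • ((1 + δ) • p) := by
        rw [smul_smul, one_div_mul_cancel h1.ne', one_smul]
      rw [e1, e2, mul_smul, ← smul_add]
      nth_rewrite 1 [e3]
      congr 1
      module
    · have h1 := hc _ hmem
      have h2 := (norm_snd_le (x, g x)).trans h1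
      have h3 := (le_abs_self (g x)).trans h2
      linarith
  · rintro ⟨z, hz, hz0, -⟩
    -- `Y` is convex by the face property, so forming the hull creates no positive height over the
    -- face of `p`.
    let Y : Set (E × ℝ) := {q | q.1 ∈ closure S ∧ (q.1 - p ∈ D → q.2 = 0)}
    have hY : Convex ℝ Y := by
      rw [convex_iff_forall_pos]
      rintro ⟨x, r⟩ ⟨hx, hr⟩ ⟨y, r'⟩ ⟨hy, hr'⟩ a b ha hb hab
      refine ⟨hK hx hy ha.le hb.le hab, fun h => ?_⟩
      have h1 := facialDirections_face hx hy ha hb hab h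
      have h2 := facialDirections_face hy hx hb ha (by linarith) (by rwa [add_comm])
      change a * r + b * r' = 0
      rw [show r = 0 from hr h1, show r' = 0 from hr' h2]
      ring
    have hGY : convexHull ℝ G ⊆ Y := by
      refine convexHull_min ?_ hY
      rintro _ ⟨x, hx, rfl⟩
      exact ⟨hx, (hg0 x).2⟩
    exact hz0.ne' ((hGY hz).2 (by simp))

/-- A drift invariant set is defined from its bounded slice by a fixed space of a projection. -/
theorem Def.of_bounded_slice {S : Set E} (hB : DriftInvariant S)
    (h : ∀ P : E →ₗ[ℝ] E, Bornology.IsBounded (S ∩ {x | P x = x}) → Def C (S ∩ {x | P x = x})) :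
    Def C S := by
  obtain ⟨P, hPP, hPS, -, hPb⟩ := hB.exists_projection
  have hb : Bornology.IsBounded (S ∩ {x | P x = x}) :=
    hPb.subset fun x hx => ⟨x, hx.1, hx.2⟩
  convert (h P hb).preimage (IsAff.linear P) using 1
  ext x
  exact ⟨fun hx => ⟨(hPS x).2 hx, hPP x⟩, fun hx => (hPS x).1 hx.1⟩

theorem Def.of_noSemident (hC : PPClosed C) (hO : Def C (Ioo (0 : ℝ) 1)) {S : Set E}
    (hS : Convex ℝ S) (hB : DriftInvariant S) (hsd : NoSemident S) : Def C S := by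
  refine Def.of_bounded_slice hB fun P hb =>
    Def.of_bounded_noSemident hC hO (hS.inter (convex_fixed P)) hb ?_
  have hcl : IsClosed {x | P x = x} :=
    isClosed_eq (LinearMap.continuous_of_finiteDimensional P) continuous_id
  intro s hs t ht c hc
  refine ⟨hsd s hs.1 t (closure_mono inter_subset_left ht) c hc, ?_⟩
  have htP : t ∈ {x | P x = x} := closure_minimal inter_subset_right hcl ht
  exact convex_fixed P hs.2 htP hc.1.le (by linarith [hc.2]) (by ring)

end Closed

/-! ### Lexicographic separation -/

section Gadget

variable {n : ℕ}

/-- Properly separate `p` from `S` by `f` and recurse on the section `f x = f p`, where the span has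
smaller dimension; hence `Q` must survive sections. If `T` separates `p` from the section, then `M`
asks for a `z` in `T` such that `Γ` holds of `f (x - p)` and each coordinate of `x - z`, scaled by
`c`. Points of the section take `z = x`, other points of `S` take the fixed `z = y`, and `p` itself
would need `z = p`. -/
theorem exists_def_separating (hC : PPClosed C) {Γ : Set (ℝ × ℝ)} (hΓ : Def C Γ)
    (h00 : (0, 0) ∈ Γ) (h0 : ∀ b, (0, b) ∈ Γ → b = 0) {Q : Set (Fin n → ℝ) → Prop}
    (hQc : ∀ S, Q S → Convex ℝ S)
    (hQs : ∀ S, Q S → ∀ (f : Module.Dual ℝ (Fin n → ℝ)) (c : ℝ), Q (S ∩ {x | f x = c}))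
    (hQΓ : ∀ S, Q S → ∀ (f : Module.Dual ℝ (Fin n → ℝ)) (p : Fin n → ℝ),
      (∀ s ∈ S, 0 ≤ f (s - p)) → ∀ y ∈ S, ∃ c : ℝ, 0 < c ∧
        ∀ x ∈ S, 0 < f (x - p) → ∀ i, (c * f (x - p), c * (x i - y i)) ∈ Γ)
    (d : ℕ) : ∀ (S : Set (Fin n → ℝ)) (p : Fin n → ℝ), Q S → S.Nonempty → p ∉ S →
      Module.finrank ℝ (Submodule.span ℝ ((fun s => s - p) '' S)) = d →
      ∃ M, Def C M ∧ S ⊆ M ∧ p ∉ M := by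
  induction d using Nat.strong_induction_on with
  | _ d ih =>
    intro S p hS hne hp hd
    obtain ⟨f, hf, s₁, hs₁, hfs₁⟩ := exists_proper_separation (hQc S hS) hne hp
    let S' := S ∩ {x | f x = f p}
    obtain ⟨T, y, hT, hpT, hyT, hyS, hS'T⟩ : ∃ (T : Set (Fin n → ℝ)) (y : Fin n → ℝ),
        Def C T ∧ p ∉ T ∧ y ∈ T ∧ y ∈ S ∧ S' ⊆ T := by
      rcases S'.eq_empty_or_nonempty with he | ⟨y, hy⟩
      · obtain ⟨y, hy⟩ := hne
        refine ⟨{y}, y, Def.eqLocus hC (f := fun x : Fin n → ℝ => x) (by fun_prop) (IsAff.const y),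
          fun h => hp ?_, rfl, hy, by simp [he]⟩
        rw [mem_singleton_iff] at h
        rwa [h]
      · have hlt : Submodule.span ℝ ((fun s => s - p) '' S') <
            Submodule.span ℝ ((fun s => s - p) '' S) := by
          refine lt_of_le_of_ne (Submodule.span_mono (image_mono inter_subset_left)) fun heq => ?_
          have hle : Submodule.span ℝ ((fun s => s - p) '' S') ≤ LinearMap.ker f := by
            rw [Submodule.span_le]
            rintro _ ⟨s, hs, rfl⟩
            have : f s = f p := hs.2
            simp [this]
          rw [heq] at hle
          have : f (s₁ - p) = 0 := hle (Submodule.subset_span ⟨s₁, hs₁, rfl⟩)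
          exact hfs₁.ne' this
        obtain ⟨T, hT, hST, hpT⟩ := ih _ (hd ▸ Submodule.finrank_lt_finrank_of_lt hlt) S' p
          (hQs S hS f (f p)) ⟨y, hy⟩ (fun h => hp h.1) rfl
        exact ⟨T, y, hT, hpT, hST hy, hy.1, hST⟩
    obtain ⟨c, hc, hΓc⟩ := hQΓ S hS f p hf y hyS
    refine ⟨{x | ∃ z, z ∈ T ∧ ∀ i, (c * f (x - p), c * (x i - z i)) ∈ Γ}, ?_, ?_, ?_⟩
    · refine Def.exists hC (Def.and hC (hT.preimage (g := fun q : (Fin n → ℝ) × (Fin n → ℝ) => q.2)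
        (by fun_prop)) (Def.forall hC fun i => hΓ.preimage
          (g := fun q : (Fin n → ℝ) × (Fin n → ℝ) => (c * f (q.1 - p), c * (q.1 i - q.2 i))) ?_))
      have h1 : IsAff fun q : (Fin n → ℝ) × (Fin n → ℝ) => f (q.1 - p) :=
        (IsAff.linear f).comp (by fun_prop)
      have h2 : IsAff fun q : (Fin n → ℝ) × (Fin n → ℝ) => q.1 i :=
        (IsAff.apply i).comp (by fun_prop)
      have h3 : IsAff fun q : (Fin n → ℝ) × (Fin n → ℝ) => q.2 i :=
        (IsAff.apply i).comp (by fun_prop)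
      fun_prop
    · intro x hx
      rcases (hf x hx).eq_or_lt with h | h
      · have hxS' : x ∈ S' := ⟨hx, by
          rw [map_sub] at h
          exact (sub_eq_zero.1 h.symm)⟩
        refine ⟨x, hS'T hxS', fun i => ?_⟩
        rw [← h]
        simpa using h00
      · exact ⟨y, hyT, hΓc x hx h⟩
    · rintro ⟨z, hz, hzΓ⟩
      have : p = z := by
        ext i
        have h1 := hzΓ i
        rw [sub_self, map_zero, mul_zero] at h1
        have := h0 _ h1
        rw [mul_eq_zero, sub_eq_zero] at this
        exact this.resolve_left hc.ne'
      exact hpT (this ▸ hz)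

theorem Def.of_gadget (hC : PPClosed C) {Γ : Set (ℝ × ℝ)} (hΓ : Def C Γ)
    (h00 : (0, 0) ∈ Γ) (h0 : ∀ b, (0, b) ∈ Γ → b = 0) {Q : Set (Fin n → ℝ) → Prop}
    (hQc : ∀ S, Q S → Convex ℝ S)
    (hQs : ∀ S, Q S → ∀ (f : Module.Dual ℝ (Fin n → ℝ)) (c : ℝ), Q (S ∩ {x | f x = c}))
    (hQΓ : ∀ S, Q S → ∀ (f : Module.Dual ℝ (Fin n → ℝ)) (p : Fin n → ℝ),
      (∀ s ∈ S, 0 ≤ f (s - p)) → ∀ y ∈ S, ∃ c : ℝ, 0 < c ∧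
        ∀ x ∈ S, 0 < f (x - p) → ∀ i, (c * f (x - p), c * (x i - y i)) ∈ Γ)
    {S : Set (Fin n → ℝ)} (hS : Q S) : Def C S := by
  rcases S.eq_empty_or_nonempty with rfl | hne
  · exact Def.empty hC
  have hsep : ∀ p, p ∉ S → ∃ M, Def C M ∧ S ⊆ M ∧ p ∉ M := fun p hp =>
    exists_def_separating hC hΓ h00 h0 hQc hQs hQΓ _ S p hS hne hp rfl
  choose! M hM hSM hpM using hsep
  convert Def.forall hC (S := fun (p : ↥Sᶜ) x => x ∈ M p) (fun p => hM p p.2) using 1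
  ext x
  refine ⟨fun hx p => hSM p p.2 hx, fun h => ?_⟩
  by_contra hx
  exact hpM x hx (h ⟨x, hx⟩)

/-- The pointed rectangle, with its coordinates exchanged. -/
def rectangleGadget : Set (ℝ × ℝ) :=
  {q | (q.1 ∈ Ioo (0 : ℝ) 1 ∧ q.2 ∈ Ioo (-1 : ℝ) 1) ∨ (q.1 = 0 ∧ q.2 = 0)}

/-- The pointed stripe, with its coordinates exchanged. -/
def stripeGadget : Set (ℝ × ℝ) := {q | q.1 ∈ Ioo (0 : ℝ) 1 ∨ (q.1 = 0 ∧ q.2 = 0)}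

/-- The pointed open half-plane. -/
def halfPlaneGadget : Set (ℝ × ℝ) := {q | 0 < q.1 ∨ (q.1 = 0 ∧ q.2 = 0)}

theorem Def.of_rectangleGadget (hC : PPClosed C) (hΓ : Def C rectangleGadget)
    {S : Set (Fin n → ℝ)} (hS : Convex ℝ S) (hB : DriftInvariant S) : Def C S := by
  refine Def.of_bounded_slice hB fun P hb => Def.of_gadget hC hΓ (Or.inr ⟨rfl, rfl⟩) ?_
    (Q := fun S => Convex ℝ S ∧ Bornology.IsBounded S) (fun S h => h.1) ?_ ?_
    ⟨hS.inter (convex_fixed P), hb⟩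
  · rintro b (⟨⟨h, -⟩, -⟩ | ⟨-, h⟩)
    exacts [absurd h (lt_irrefl _), h]
  · exact fun S h f c => ⟨h.1.inter ((convex_singleton c).linear_preimage f),
      h.2.subset inter_subset_left⟩
  · rintro S ⟨-, hb⟩ f p hf y -
    obtain ⟨a, ha⟩ := mem_bddDual_of_isBounded hb f
    obtain ⟨r, hr⟩ := hb.exists_norm_le
    -- The sum dominates both `f (x - p)` and every coordinate of `x - y`, so its inverse scales all
    -- pairs into the rectangle.
    have hk : 0 < |a| + |f p| + |r| + ‖y‖ + 1 := by positivity
    refine ⟨(|a| + |f p| + |r| + ‖y‖ + 1)⁻¹, inv_pos.2 hk, fun x hx hpos i => Or.inl ⟨⟨?_, ?_⟩, ?_, ?_⟩⟩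
    · exact mul_pos (inv_pos.2 hk) hpos
    · rw [inv_mul_lt_iff₀ hk, map_sub]
      have h1 := (le_abs_self _).trans (ha x hx)
      have h2 := le_abs_self a
      have h3 := neg_abs_le (f p)
      have h4 := abs_nonneg r
      have h5 := norm_nonneg y
      linarith
    all_goals
      have h1 := abs_le.1 ((norm_le_pi_norm x i).trans (hr x hx))
      have h2 := abs_le.1 (norm_le_pi_norm y i)
      have h3 := le_abs_self r
      have h4 := abs_nonneg a
      have h5 := abs_nonneg (f p)
      simp only
    · rw [lt_inv_mul_iff₀ hk]; linarith [h1.1, h2.2]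
    · rw [inv_mul_lt_iff₀ hk]; linarith [h1.2, h2.1]

theorem Def.of_stripeGadget (hC : PPClosed C) (hΓ : Def C stripeGadget)
    {S : Set (Fin n → ℝ)} (hS : Convex ℝ S) (hray : NoRay S) : Def C S := by
  refine Def.of_gadget hC hΓ (Or.inr ⟨rfl, rfl⟩) ?_
    (Q := fun S => Convex ℝ S ∧ NoRay S) (fun S h => h.1) ?_ ?_ ⟨hS, hray⟩
  · rintro b (⟨h, -⟩ | ⟨-, h⟩)
    exacts [absurd h (lt_irrefl _), h]
  · exact fun S h f c => ⟨h.1.inter ((convex_singleton c).linear_preimage f),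
      h.2.inter ((NoRay.singleton c).preimage f.toAffineMap)⟩
  · rintro S ⟨hS, hray⟩ f p hf y -
    -- The stripe restricts only the first coordinate, so only `f` has to be bounded on `S`.
    obtain ⟨d, hd⟩ := hray.bddAbove hS f (c := f p) fun s hs => by
      have := hf s hs
      rw [map_sub] at this
      linarith
    have hk : 0 < |d| + |f p| + 1 := by positivity
    refine ⟨(|d| + |f p| + 1)⁻¹, inv_pos.2 hk, fun x hx hpos i => Or.inl ⟨?_, ?_⟩⟩
    · exact mul_pos (inv_pos.2 hk) hpos
    · rw [inv_mul_lt_iff₀ hk, map_sub]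
      have h1 := hd x hx
      have h2 := le_abs_self d
      have h3 := neg_abs_le (f p)
      linarith

/-- The form `a t² + 2 b t + c` is nonnegative for some `c` exactly if `a > 0` or `a = b = 0`. For
fixed `t` the condition is linear in `(a, b, c)`, so it becomes an infinite conjunction of ray
conditions. -/
theorem Def.halfPlaneGadget (hC : PPClosed C) (hR : Def C (Ici (0 : ℝ))) :
    Def C halfPlaneGadget := by
  convert Def.exists hC (E := ℝ × ℝ) (F := ℝ)
    (S := fun q c => q.1 ∈ Ici (0 : ℝ) ∧ ∀ t : ℝ, t ^ 2 * q.1 + 2 * t * q.2 + c ∈ Ici (0 : ℝ))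
    (Def.and hC (hR.preimage (g := fun q : (ℝ × ℝ) × ℝ => q.1.1) (by fun_prop))
      (Def.forall hC fun t => hR.preimage
        (g := fun q : (ℝ × ℝ) × ℝ => t ^ 2 * q.1.1 + 2 * t * q.1.2 + q.2) (by fun_prop))) using 1
  ext ⟨a, b⟩
  constructor
  · rintro (h | ⟨h1, h2⟩)
    · change 0 < a at h
      refine ⟨b ^ 2 / a, h.le, fun t => ?_⟩
      change 0 ≤ t ^ 2 * a + 2 * t * b + b ^ 2 / a
      have : t ^ 2 * a + 2 * t * b + b ^ 2 / a = (t * a + b) ^ 2 / a := by field_simp; ring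
      rw [this]
      positivity
    · change a = 0 at h1
      change b = 0 at h2
      refine ⟨0, h1.ge, fun t => ?_⟩
      change 0 ≤ t ^ 2 * a + 2 * t * b + 0
      simp [h1, h2]
  · rintro ⟨c, ha, h⟩
    change 0 ≤ a at ha
    rcases ha.eq_or_lt with rfl | ha
    · refine Or.inr ⟨rfl, ?_⟩
      by_contra hb
      change b ≠ 0 at hb
      have := h (-(|c| + 1) / (2 * b))
      change 0 ≤ (-(|c| + 1) / (2 * b)) ^ 2 * 0 + 2 * (-(|c| + 1) / (2 * b)) * b + c at this
      have e : 2 * (-(|c| + 1) / (2 * b)) * b = -(|c| + 1) := by field_simp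
      rw [e] at this
      have := le_abs_self c
      linarith
    · exact Or.inl ha

theorem Def.of_ray (hC : PPClosed C) (hR : Def C (Ici (0 : ℝ)))
    {S : Set (Fin n → ℝ)} (hS : Convex ℝ S) : Def C S := by
  refine Def.of_gadget hC (Def.halfPlaneGadget hC hR) (Or.inr ⟨rfl, rfl⟩) ?_
    (Q := fun S => Convex ℝ S) (fun S h => h) ?_ ?_ hS
  · rintro b (h | ⟨-, h⟩)
    exacts [absurd h (lt_irrefl _), h]
  · exact fun S h f c => h.inter ((convex_singleton c).linear_preimage f)
  · exact fun S _ f p _ y _ => ⟨1, one_pos, fun x _ hpos i => Or.inl (by simpa using hpos)⟩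

end Gadget

end Building

/-! ### Defining the representatives from convex sets -/

section Extracting

open Set

variable {C : ∀ m : ℕ, Set (Fin m → ℝ) → Prop}

theorem NoRay.bddBelow_real {A : Set ℝ} (h : NoRay A) (hA : Convex ℝ A) {b : ℝ}
    (hb : ∀ x ∈ A, x ≤ b) : ∃ a, ∀ x ∈ A, a ≤ x := by
  obtain ⟨d, hd⟩ := h.bddAbove hA (-LinearMap.id) (c := -b) fun x hx => by
    simpa using hb x hx
  exact ⟨-d, fun x hx => by have := hd x hx; simp at this; linarith⟩

/-- The missing point bounds the interval on one side, and `NoRay` then bounds it on the other. -/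
theorem NoRay.bounded_real {A : Set ℝ} (h : NoRay A) (hA : Convex ℝ A) {x y : ℝ}
    (hx : x ∈ A) (hy : y ∉ A) : ∃ a b, ∀ z ∈ A, a ≤ z ∧ z ≤ b := by
  rcases lt_or_ge x y with hxy | hxy
  · have hb : ∀ z ∈ A, z ≤ y := fun z hz => by
      by_contra! hlt
      exact hy (hA.ordConnected.out hx hz ⟨hxy.le, hlt.le⟩)
    obtain ⟨a, ha⟩ := h.bddBelow_real hA hb
    exact ⟨a, y, fun z hz => ⟨ha z hz, hb z hz⟩⟩
  · have hb : ∀ z ∈ A, y ≤ z := fun z hz => by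
      by_contra! hlt
      exact hy (hA.ordConnected.out hz hx ⟨hlt.le, hxy⟩)
    obtain ⟨b, hb'⟩ := h.bddAbove hA LinearMap.id (c := y) hb
    exact ⟨y, b, fun z hz => ⟨hb z hz, hb' z hz⟩⟩

/-! ### Traces on lines -/

section Lines

variable {E : Type*} [AddCommGroup E] [Module ℝ E] {S : Set E}

theorem isAff_line (v w : E) : IsAff fun x : ℝ => v + x • w := by fun_prop

theorem Convex.preimage_isAff {F : Type*} [AddCommGroup F] [Module ℝ F] {g : F → E}
    (hS : Convex ℝ S) (hg : IsAff g) : Convex ℝ {x | g x ∈ S} := by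
  obtain ⟨g', rfl⟩ := hg
  exact hS.affine_preimage g'

theorem NoRay.preimage_isAff {F : Type*} [AddCommGroup F] [Module ℝ F] {g : F → E}
    (hS : NoRay S) (hg : IsAff g) : NoRay {x | g x ∈ S} := by
  obtain ⟨g', rfl⟩ := hg
  exact hS.preimage g'

theorem exists_affineSubspace_of_lines (h : ∀ a ∈ S, ∀ b ∈ S, ∀ x : ℝ, a + x • (b - a) ∈ S) :
    ∃ A : AffineSubspace ℝ E, S = A := by
  refine ⟨⟨S, ?_⟩, rfl⟩
  intro c p₁ p₂ p₃ h₁ h₂ h₃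
  -- The point `p₃ + c • (p₁ - p₂)` is the midpoint of points on the lines from `p₃` through `p₁`
  -- and through `p₂`.
  have h4 := h _ (h _ h₃ _ h₁ (2 * c)) _ (h _ h₃ _ h₂ (-(2 * c))) (1 / 2)
  convert h4 using 1
  simp only [vsub_eq_sub, vadd_eq_add]
  module

/-- The trace on the offending line is a half-line whose endpoint may be missing; intersecting its
shifts by all `ε > 0` closes it. -/
theorem Def.ray_of_not_noRay (hC : PPClosed C) (hD : Def C S) (hS : Convex ℝ S) (h : ¬ NoRay S) :
    Def C (Ici (0 : ℝ)) := by
  simp only [NoRay] at h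
  push Not at h
  obtain ⟨v, w, hvw, x₀, hx₀⟩ := h
  let A : Set ℝ := {x | v + x • w ∈ S}
  have hA : Convex ℝ A := Convex.preimage_isAff hS (isAff_line v w)
  have hlow : ∀ x ∈ A, x₀ ≤ x := fun x hx => by
    by_contra! hlt
    exact hx₀ (hA.ordConnected.out hx (hvw (|x₀| + 1) (by positivity))
      ⟨hlt.le, by have := le_abs_self x₀; linarith⟩)
  have hne : A.Nonempty := ⟨1, hvw 1 one_pos⟩
  convert Def.forall hC (S := fun (ε : {ε : ℝ // 0 < ε}) (x : ℝ) => v + (sInf A + x + ε) • w ∈ S)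
    (fun ε => hD.preimage (g := fun x : ℝ => v + (sInf A + x + ε) • w) (by fun_prop)) using 1
  ext x
  constructor
  · rintro hx ⟨ε, hε⟩
    change 0 ≤ x at hx
    change sInf A + x + ε ∈ A
    obtain ⟨y, hy, hlt⟩ := exists_lt_of_csInf_lt hne (by linarith : sInf A < sInf A + x + ε)
    rcases le_or_gt (sInf A + x + ε) 0 with h0 | h0
    · exact hA.ordConnected.out hy (hvw 1 one_pos) ⟨hlt.le, by linarith⟩
    · exact hvw _ h0
  · intro hx
    change 0 ≤ x
    refine le_of_forall_pos_le_add fun ε hε => ?_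
    have := csInf_le ⟨x₀, hlow⟩ (show sInf A + x + ε ∈ A from hx ⟨ε, hε⟩)
    linarith

end Lines

/-! ### Intervals and plane gadgets carved out of traces -/

section Normed

variable {E : Type} [NormedAddCommGroup E] [NormedSpace ℝ E] {S : Set E}

theorem Def.icc_of_isClosed (hD : Def C S) (hS : Convex ℝ S) (hcl : IsClosed S)
    (hray : NoRay S) (hA : ¬ ∃ A : AffineSubspace ℝ E, S = A) : Def C (Icc (0 : ℝ) 1) := by
  have h := mt exists_affineSubspace_of_lines hA
  push Not at h
  obtain ⟨a, ha, b, hb, x₀, hx₀⟩ := h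
  let A : Set ℝ := {x | a + x • (b - a) ∈ S}
  have hAff := isAff_line a (b - a)
  have hAc : Convex ℝ A := Convex.preimage_isAff hS hAff
  have h0 : (0 : ℝ) ∈ A := by simpa [A] using ha
  have h1 : (1 : ℝ) ∈ A := by simpa [A] using hb
  obtain ⟨l, u, hlu⟩ := (hray.preimage_isAff hAff).bounded_real hAc h0 hx₀
  have hAcl : IsClosed A := hcl.preimage (by fun_prop)
  have hAb : Bornology.IsBounded A := (Metric.isBounded_Icc l u).subset hlu
  have hAcpt : IsCompact A := Metric.isCompact_of_isClosed_isBounded hAcl hAb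
  have hAI : A = Icc (sInf A) (sSup A) :=
    eq_Icc_of_connected_compact ⟨⟨0, h0⟩, hAc.isPreconnected⟩ hAcpt
  have hlt : sInf A < sSup A := by
    rw [hAI] at h0 h1
    linarith [h0.1, h1.2]
  have hDA : Def C A := hD.preimage hAff
  rw [hAI] at hDA
  convert hDA.preimage (g := fun x : ℝ => sInf A + x * (sSup A - sInf A)) (by fun_prop) using 1
  have hpos : 0 < sSup A - sInf A := sub_pos.2 hlt
  ext x
  change 0 ≤ x ∧ x ≤ 1 ↔ sInf A ≤ sInf A + x * (sSup A - sInf A) ∧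
    sInf A + x * (sSup A - sInf A) ≤ sSup A
  constructor
  · rintro ⟨h1, h2⟩
    constructor <;> nlinarith
  · rintro ⟨h1, h2⟩
    constructor <;> nlinarith

variable [FiniteDimensional ℝ E]

/-- On the line from a core point to a missing limit point, the trace is an interval that is open at
one end. Intersecting it with its mirror image makes both ends open. -/
theorem Def.ioo_of_not_isClosed (hC : PPClosed C) (hD : Def C S) (hS : Convex ℝ S)
    (hray : NoRay S) (hcl : ¬ IsClosed S) : Def C (Ioo (0 : ℝ) 1) := by
  have hnsub : ¬ closure S ⊆ S := fun h => hcl (isClosed_of_closure_subset h)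
  obtain ⟨t, ht, htS⟩ := not_subset.1 hnsub
  obtain ⟨u, hu, hcore⟩ := exists_core_point hS (closure_nonempty_iff.1 ⟨t, ht⟩)
  let A : Set ℝ := {x | u + x • (t - u) ∈ S}
  have hAff := isAff_line u (t - u)
  have hAc : Convex ℝ A := Convex.preimage_isAff hS hAff
  have hIco : ∀ x, 0 ≤ x → x < 1 → x ∈ A := by
    intro x h0 h1
    have := hcore t ht (1 - x) ⟨by linarith, by linarith⟩
    change u + x • (t - u) ∈ S
    convert this using 1
    module
  have h0 : (0 : ℝ) ∈ A := hIco 0 le_rfl one_pos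
  have h1 : (1 : ℝ) ∉ A := by simpa [A] using htS
  have hlt1 : ∀ x ∈ A, x < 1 := fun x hx => by
    by_contra! hle
    exact h1 (hAc.ordConnected.out h0 hx ⟨zero_le_one, hle⟩)
  obtain ⟨l, hl⟩ := (hray.preimage_isAff hAff).bddBelow_real hAc fun x hx => (hlt1 x hx).le
  have hbdd : BddBelow A := ⟨l, hl⟩
  let a := sInf A
  have ha0 : a ≤ 0 := csInf_le hbdd h0
  have hmem : ∀ x, a < x → x < 1 → x ∈ A := by
    intro x hax hx1
    obtain ⟨y, hy, hyx⟩ := exists_lt_of_csInf_lt ⟨0, h0⟩ hax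
    rcases le_or_gt 0 x with h | h
    · exact hIco x h hx1
    · exact hAc.ordConnected.out hy h0 ⟨hyx.le, h.le⟩
  have hDA : Def C A := hD.preimage hAff
  convert Def.and hC
    (hDA.preimage (g := fun x : ℝ => a + x * (1 - a)) (by fun_prop))
    (hDA.preimage (g := fun x : ℝ => 1 - x * (1 - a)) (by fun_prop)) using 1
  ext x
  have hpos : 0 < 1 - a := by linarith
  constructor
  · rintro ⟨h1, h2⟩
    constructor <;> refine hmem _ ?_ ?_ <;> nlinarith
  · rintro ⟨h1, h2⟩
    have h1' := hlt1 _ h1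
    have h2' := hlt1 _ h2
    constructor <;> nlinarith

theorem Def.rectangleGadget_of_semident (hC : PPClosed C) (hD : Def C S) (hS : Convex ℝ S)
    (hO : Def C (Ioo (0 : ℝ) 1)) (hsd : ¬ NoSemident S) : Def C rectangleGadget := by
  simp only [NoSemident] at hsd
  push Not at hsd
  obtain ⟨s, hs, t, ht, c, ⟨hc0, hc1⟩, hst⟩ := hsd
  obtain ⟨u, hu, hcore⟩ := exists_core_point hS ⟨s, hs⟩
  -- In these coordinates `s`, `t`, `u` are `(0,0)`, `(1,0)`, `(0,1)`, and the semident is `(1 - c,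
  -- 0)`.
  let Q : Set (ℝ × ℝ) := {q | s + q.1 • (t - s) + q.2 • (u - s) ∈ S}
  have hQD : Def C Q :=
    hD.preimage (g := fun q : ℝ × ℝ => s + q.1 • (t - s) + q.2 • (u - s)) (by fun_prop)
  have hQ0 : ((0 : ℝ), (0 : ℝ)) ∈ Q := by simpa [Q] using hs
  have hQtri : ∀ x y : ℝ, 0 ≤ x → 0 < y → x + y ≤ 1 → (x, y) ∈ Q := by
    intro x y hx hy hxy
    have hpos : 0 < x + y := by linarith
    have h1 := hcore t ht (y / (x + y)) ⟨by positivity, (div_le_one hpos).2 (by linarith)⟩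
    have h2 := hS hs h1 (by linarith : 0 ≤ 1 - (x + y)) hpos.le (by ring)
    change s + x • (t - s) + y • (u - s) ∈ S
    convert h2 using 1
    have e1 : (x + y) * (y / (x + y)) = y := mul_div_cancel₀ _ hpos.ne'
    have e2 : (x + y) * (1 - y / (x + y)) = x := by rw [mul_sub, e1]; ring
    rw [smul_add, smul_smul, smul_smul, e1, e2]
    module
  have hQlt : ∀ x : ℝ, (x, (0 : ℝ)) ∈ Q → x < 1 - c := by
    intro x hx
    by_contra! hle
    have hx' : s + x • (t - s) ∈ S := by
      have : s + x • (t - s) + (0 : ℝ) • (u - s) ∈ S := hx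
      simpa using this
    have hxpos : 0 < x := by linarith
    have := hS hs hx' (sub_nonneg.2 ((div_le_one hxpos).2 hle))
      (by have : 0 < 1 - c := by linarith
          positivity : 0 ≤ (1 - c) / x) (by ring)
    refine hst ?_
    convert this using 1
    have e : (1 - c) / x * x = 1 - c := div_mul_cancel₀ _ hxpos.ne'
    rw [smul_add, smul_smul, e]
    module
  -- The last condition asks that the shift carry the nonnegative axis part of `Q` into `Q`. As that
  -- part is bounded, only the zero shift along the axis survives; off the axis, the bound `c` keeps
  -- the shifts inside the triangle.
  let H : Set (ℝ × ℝ) := {q | q.1 ∈ Ico (0 : ℝ) 1 ∧ q.2 ∈ Ico (0 : ℝ) 1 ∧ q.1 + q.2 ∈ Ico 0 c ∧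
    ∀ z : {z : ℝ // 0 ≤ z ∧ (z, (0 : ℝ)) ∈ Q}, ((z : ℝ) + q.1, q.2) ∈ Q}
  have hHD : Def C H :=
    Def.and hC ((Def.ico hC hO _ _).preimage (g := fun q : ℝ × ℝ => q.1) (by fun_prop)) <|
    Def.and hC ((Def.ico hC hO _ _).preimage (g := fun q : ℝ × ℝ => q.2) (by fun_prop)) <|
    Def.and hC ((Def.ico hC hO _ _).preimage (g := fun q : ℝ × ℝ => q.1 + q.2) (by fun_prop)) <|
    Def.forall hC fun z => hQD.preimage (g := fun q : ℝ × ℝ => ((z : ℝ) + q.1, q.2)) (by fun_prop)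
  have hHtri : ∀ x y : ℝ, 0 ≤ x → 0 < y → x + y < c → (x, y) ∈ H := by
    intro x y hx hy hxy
    refine ⟨⟨hx, ?_⟩, ⟨hy.le, ?_⟩, ⟨?_, hxy⟩, fun z => ?_⟩
    · change x < 1; linarith
    · change y < 1; linarith
    · change 0 ≤ x + y; linarith
    · have := hQlt _ z.2.2
      exact hQtri _ _ (add_nonneg z.2.1 hx) hy (by linarith)
  have hH0 : ((0 : ℝ), (0 : ℝ)) ∈ H := by
    refine ⟨⟨le_rfl, one_pos⟩, ⟨le_rfl, one_pos⟩, ⟨?_, ?_⟩, fun z => ?_⟩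
    · change (0 : ℝ) ≤ 0 + 0; simp
    · change (0 : ℝ) + 0 < c; simpa using hc0
    · simpa using z.2.2
  have hHaxis : ∀ x : ℝ, (x, (0 : ℝ)) ∈ H → x = 0 := by
    rintro x ⟨⟨hx0, -⟩, -, -, hx⟩
    change 0 ≤ x at hx0
    have hk : ∀ k : ℕ, (k * x, (0 : ℝ)) ∈ Q := by
      intro k
      induction k with
      | zero => simpa using hQ0
      | succ k ih =>
        have := hx ⟨k * x, by positivity, ih⟩
        push_cast
        rwa [add_mul, one_mul]
    by_contra hne
    have hxpos : 0 < x := lt_of_le_of_ne hx0 (Ne.symm hne)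
    obtain ⟨k, hk'⟩ := exists_nat_gt (1 / x)
    rw [div_lt_iff₀ hxpos] at hk'
    have := hQlt _ (hk k)
    linarith
  have hpos : 0 < c / 2 := by positivity
  -- The heights of two points of `H` sum to `c / 2 * a` and their abscissas differ by `c / 2 * b`;
  -- taking a difference admits both signs of `b`. If `a = 0`, both points are the origin.
  convert Def.and hC ((Def.ico hC hO 0 1).preimage (g := fun q : ℝ × ℝ => q.1) (by fun_prop)) <|
    Def.and hC ((Def.ioo hC hO (-1) 1).preimage (g := fun q : ℝ × ℝ => q.2) (by fun_prop)) <|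
    Def.exists hC (E := ℝ × ℝ) (F := ℝ × ℝ)
      (S := fun q r => r ∈ H ∧ (r.1 - c / 2 * q.2, c / 2 * q.1 - r.2) ∈ H) <|
    Def.and hC (hHD.preimage (g := fun q : (ℝ × ℝ) × (ℝ × ℝ) => q.2) (by fun_prop))
      (hHD.preimage (g := fun q : (ℝ × ℝ) × (ℝ × ℝ) =>
        (q.2.1 - c / 2 * q.1.2, c / 2 * q.1.1 - q.2.2)) (by fun_prop)) using 1
  ext ⟨a, b⟩
  constructor
  · rintro (⟨⟨ha0, ha1⟩, hb0, hb1⟩ | ⟨ha, hb⟩)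
    · change 0 < a at ha0
      change a < 1 at ha1
      change -1 < b at hb0
      change b < 1 at hb1
      -- The abscissas are the positive and negative parts of `c / 2 * b`, and the height is split
      -- evenly.
      refine ⟨⟨ha0.le, ha1⟩, ⟨hb0, hb1⟩, (max (c / 2 * b) 0, c / 2 * a / 2), ?_, ?_⟩
      · refine hHtri _ _ (le_max_right _ _) (by positivity) ?_
        have : max (c / 2 * b) 0 ≤ c / 2 := max_le (by nlinarith) hpos.le
        nlinarith
      · refine hHtri _ _ (sub_nonneg.2 (le_max_left _ _)) ?_ ?_
        · change 0 < c / 2 * a - c / 2 * a / 2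
          nlinarith
        · change max (c / 2 * b) 0 - c / 2 * b + (c / 2 * a - c / 2 * a / 2) < c
          have : max (c / 2 * b) 0 ≤ c / 2 * b + c / 2 := max_le (by linarith) (by nlinarith)
          nlinarith
    · change a = 0 at ha
      change b = 0 at hb
      subst ha hb
      refine ⟨⟨le_rfl, one_pos⟩, ⟨by norm_num, by norm_num⟩, (0, 0), hH0, ?_⟩
      simpa using hH0
  · rintro ⟨⟨ha0, ha1⟩, ⟨hb0, hb1⟩, ⟨x, y⟩, h1, h2⟩
    change 0 ≤ a at ha0
    rcases ha0.eq_or_lt with rfl | ha0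
    · refine Or.inr ⟨rfl, ?_⟩
      have hy0 : 0 ≤ y := h1.2.1.1
      have hy1 : 0 ≤ c / 2 * 0 - y := h2.2.1.1
      obtain rfl : y = 0 := by linarith
      have hx := hHaxis x h1
      simp only [mul_zero, sub_zero] at h2
      have hxb := hHaxis _ h2
      rw [hx, zero_sub, neg_eq_zero, mul_eq_zero] at hxb
      exact hxb.resolve_left hpos.ne'
    · exact Or.inl ⟨⟨ha0, ha1⟩, hb0, hb1⟩

theorem Def.stripeGadget_of_not_driftInvariant (hC : PPClosed C) (hD : Def C S) (hS : Convex ℝ S)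
    (hray : NoRay S) (hB : ¬ DriftInvariant S) : Def C stripeGadget := by
  simp only [DriftInvariant] at hB
  push Not at hB
  obtain ⟨w, hw, s, hs, hsw⟩ := hB
  obtain ⟨u, hu, hud⟩ := hray.exists_add_drift_mem hS ⟨s, hs⟩
  -- The trace contains all of `ℝ × (0,1]`, but on the axis only a bounded interval `J`.
  let Q : Set (ℝ × ℝ) := {q | s + q.1 • w + q.2 • (u - s) ∈ S}
  have hQD : Def C Q :=
    hD.preimage (g := fun q : ℝ × ℝ => s + q.1 • w + q.2 • (u - s)) (by fun_prop)
  have hQs : ∀ x y : ℝ, 0 < y → y ≤ 1 → (x, y) ∈ Q := by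
    intro x y hy hy1
    have := hS hs (hud ((x / y) • w) (Submodule.smul_mem _ _ hw)) (by linarith : 0 ≤ 1 - y) hy.le
      (by ring)
    change s + x • w + y • (u - s) ∈ S
    convert this using 1
    have e : y * (x / y) = x := mul_div_cancel₀ _ hy.ne'
    rw [smul_add, smul_smul, e]
    module
  have hncl : ¬ IsClosed S := by
    intro hcl
    refine hsw ?_
    have hlim : Filter.Tendsto (fun n : ℕ => s + (1 : ℝ) • w + (1 / ((n : ℝ) + 1)) • (u - s))
        Filter.atTop (nhds (s + (1 : ℝ) • w + (0 : ℝ) • (u - s))) :=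
      ((tendsto_one_div_add_atTop_nhds_zero_nat (𝕜 := ℝ)).smul_const (u - s)).const_add _
    have := hcl.mem_of_tendsto hlim (Filter.Eventually.of_forall fun n => hQs 1 _ (by positivity) (by
      rw [div_le_one (by positivity)]; have := n.cast_nonneg (α := ℝ); linarith))
    simpa using this
  have hO := Def.ioo_of_not_isClosed hC hD hS hray hncl
  let J : Set ℝ := {x | s + x • w ∈ S}
  have hJQ : ∀ x, x ∈ J ↔ (x, (0 : ℝ)) ∈ Q := by
    intro x
    change s + x • w ∈ S ↔ s + x • w + (0 : ℝ) • (u - s) ∈ S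
    simp
  have hAff := isAff_line s w
  have hJc : Convex ℝ J := Convex.preimage_isAff hS hAff
  have h0 : (0 : ℝ) ∈ J := by simpa [J] using hs
  have h1 : (1 : ℝ) ∉ J := by simpa [J] using hsw
  obtain ⟨l, b, hlb⟩ := (hray.preimage_isAff hAff).bounded_real hJc h0 h1
  convert Def.and hC ((Def.ico hC hO 0 1).preimage (g := fun q : ℝ × ℝ => q.1) (by fun_prop))
    (Def.forall hC (S := fun (z : J) (q : ℝ × ℝ) => ((z : ℝ) + q.2, q.1) ∈ Q) fun z =>
      hQD.preimage (g := fun q : ℝ × ℝ => ((z : ℝ) + q.2, q.1)) (by fun_prop)) using 1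
  ext ⟨a, x⟩
  constructor
  · rintro (⟨ha0, ha1⟩ | ⟨ha, hx⟩)
    · exact ⟨⟨ha0.le, ha1⟩, fun z => hQs _ _ ha0 ha1.le⟩
    · change a = 0 at ha
      change x = 0 at hx
      subst ha hx
      refine ⟨⟨le_rfl, one_pos⟩, fun z => ?_⟩
      change ((z : ℝ) + 0, (0 : ℝ)) ∈ Q
      rw [add_zero]
      exact (hJQ _).1 z.2
  · rintro ⟨⟨ha0, ha1⟩, h⟩
    change 0 ≤ a at ha0
    rcases ha0.eq_or_lt with rfl | ha0
    · refine Or.inr ⟨rfl, ?_⟩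
      change x = 0
      have hk : ∀ k : ℕ, k * x ∈ J := by
        intro k
        induction k with
        | zero => simpa using h0
        | succ k ih =>
          have := (hJQ _).2 (h ⟨k * x, ih⟩)
          push_cast
          rwa [add_mul, one_mul]
      by_contra hne
      obtain ⟨k, hk'⟩ := exists_nat_gt ((|l| + |b|) / |x|)
      rw [div_lt_iff₀ (abs_pos.2 hne)] at hk'
      have h2 := hlb _ (hk k)
      have h3 : k * |x| = |k * x| := by rw [abs_mul, Nat.abs_cast]
      have h4 : |k * x| ≤ |l| + |b| := abs_le.2
        ⟨by linarith [neg_abs_le l, abs_nonneg b], by linarith [le_abs_self b, abs_nonneg l]⟩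
      linarith
    · exact Or.inl ⟨ha0, ha1⟩

end Normed

end Extracting

/-! ### The six classes -/

section Classes

open Set

/-! ### Stability of the absence of semidents -/

section Semidents

variable {E F : Type*} [NormedAddCommGroup E] [NormedSpace ℝ E]
  [NormedAddCommGroup F] [NormedSpace ℝ F]

theorem NoSemident.iInter {ι : Type*} {S : ι → Set E} (h : ∀ i, NoSemident (S i)) :
    NoSemident (⋂ i, S i) := fun s hs t ht c hc => mem_iInter.2 fun i =>
  h i s (mem_iInter.1 hs i) t (closure_mono (iInter_subset _ i) ht) c hc

theorem IsClosed.noSemident {S : Set E} (hcl : IsClosed S) (hS : Convex ℝ S) : NoSemident S := by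
  intro s hs t ht c hc
  rw [hcl.closure_eq] at ht
  exact hS hs ht hc.1.le (by linarith [hc.2]) (by ring)

theorem NoSemident.preimage [FiniteDimensional ℝ E] {T : Set F} (h : NoSemident T) (g : E →ᵃ[ℝ] F) :
    NoSemident (g ⁻¹' T) := by
  intro s hs t ht c hc
  have hg : Continuous g := AffineMap.continuous_of_finiteDimensional g
  have ht' : g t ∈ closure T := map_mem_closure hg ht fun x hx => hx
  have := h _ hs _ ht' c hc
  rw [mem_preimage]
  convert this using 1
  exact Convex.combo_affine_apply (by ring)

end Semidents

/-! ### Closures of linear images -/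

section Images

variable {E F : Type*} [NormedAddCommGroup E] [NormedSpace ℝ E] [FiniteDimensional ℝ E]
  [NormedAddCommGroup F] [NormedSpace ℝ F] [FiniteDimensional ℝ F] {S : Set E}

theorem isClosed_add_submodule {B : Set E} (hB : IsCompact B) (V : Submodule ℝ E) :
    IsClosed (B + (V : Set E)) :=
  (Submodule.closed_of_finiteDimensional V).add_left_of_isCompact hB

/-- A drift invariant set is the sum of a bounded slice and its drift. -/
theorem DriftInvariant.exists_eq_add (hB : DriftInvariant S) : ∃ P : E →ₗ[ℝ] E,
    Bornology.IsBounded (S ∩ {x | P x = x}) ∧ S = S ∩ {x | P x = x} + (drift S : Set E) := by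
  obtain ⟨P, hPP, hPS, hPd, hPb⟩ := hB.exists_projection
  refine ⟨P, hPb.subset fun x hx => ⟨x, hx.1, hx.2⟩, Subset.antisymm (fun x hx => ?_) ?_⟩
  · exact ⟨P x, ⟨(hPS x).2 hx, hPP x⟩, x - P x, hPd x, add_sub_cancel _ _⟩
  · rintro _ ⟨b, hb, v, hv, rfl⟩
    exact hB v hv b hb.1

/-- Images of closed convex sets need not be closed. Here the closure of the bounded slice is
compact, and a compact set plus a subspace is closed. -/
theorem DriftInvariant.closure_image_subset (hB : DriftInvariant S) (f : E →ₗ[ℝ] F) :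
    closure (f '' S) ⊆ f '' closure S := by
  obtain ⟨P, hb, hS⟩ := hB.exists_eq_add
  have hf : Continuous f := LinearMap.continuous_of_finiteDimensional f
  have hcl : IsClosed (f '' closure (S ∩ {x | P x = x}) + ((drift S).map f : Set F)) :=
    isClosed_add_submodule (hb.isCompact_closure.image hf) _
  refine (closure_minimal ?_ hcl).trans ?_
  · nth_rewrite 1 [hS]
    rintro _ ⟨_, ⟨b, hb, v, hv, rfl⟩, rfl⟩
    rw [map_add]
    exact add_mem_add ⟨b, subset_closure hb, rfl⟩ ⟨v, hv, rfl⟩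
  · rintro _ ⟨_, ⟨b, hb, rfl⟩, _, ⟨v, hv, rfl⟩, rfl⟩
    refine ⟨b + v, ?_, map_add _ _ _⟩
    exact map_mem_closure (f := fun x => x + v) (by fun_prop)
      (closure_mono inter_subset_left hb) fun s hs => hB v hv s hs

theorem NoSemident.image (hsd : NoSemident S) (hB : DriftInvariant S) (f : E →ₗ[ℝ] F) :
    NoSemident (f '' S) := by
  rintro _ ⟨s, hs, rfl⟩ _ ht' c hc
  obtain ⟨t, ht, rfl⟩ := hB.closure_image_subset f ht'
  exact ⟨_, hsd s hs t ht c hc, by simp⟩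

theorem DriftInvariant.isClosed_image (hB : DriftInvariant S) (hcl : IsClosed S) (f : E →ₗ[ℝ] F) :
    IsClosed (f '' S) :=
  isClosed_of_closure_subset ((hB.closure_image_subset f).trans_eq (by rw [hcl.closure_eq]))

theorem AffineSubspace.driftInvariant (A : AffineSubspace ℝ E) : DriftInvariant (A : Set E) := by
  rcases (A : Set E).eq_empty_or_nonempty with h | ⟨p, hp⟩
  · rw [h]
    exact DriftInvariant.empty
  · have : (A : Set E) = {p} + (A.direction : Set E) := by
      ext x
      rw [singleton_add, SetLike.mem_coe, ← AffineSubspace.vsub_right_mem_direction_iff_mem hp]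
      constructor
      · exact fun h => ⟨x - p, h, add_sub_cancel _ _⟩
      · rintro ⟨v, hv, rfl⟩
        simpa using hv
    rw [this]
    exact driftInvariant_add_submodule Bornology.isBounded_singleton _

end Images

/-- The sets whose class number (counted from `0`) is at most `k`. -/
def ClassAtMost (k : ℕ) (m : ℕ) (S : Set (Fin m → ℝ)) : Prop :=
  match k with
  | 0 => IsEmptyOrAffine S
  | 1 => Convex ℝ S ∧ DriftInvariant S ∧ IsClosed S
  | 2 => Convex ℝ S ∧ DriftInvariant S ∧ NoSemident S
  | 3 => Convex ℝ S ∧ DriftInvariant S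
  | 4 => Convex ℝ S ∧ NoRay S
  | _ + 5 => Convex ℝ S

theorem ClassAtMost.succ {k m : ℕ} {S : Set (Fin m → ℝ)} (h : ClassAtMost k m S) :
    ClassAtMost (k + 1) m S := by
  match k with
  | 0 =>
    obtain ⟨A, rfl⟩ := h
    exact ⟨A.convex, AffineSubspace.driftInvariant A, AffineSubspace.closed_of_finiteDimensional A⟩
  | 1 => exact ⟨h.1, h.2.1, IsClosed.noSemident h.2.2 h.1⟩
  | 2 => exact ⟨h.1, h.2.1⟩
  | 3 => exact ⟨h.1, h.2.noRay⟩
  | 4 => exact h.1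
  | _ + 5 => exact h

theorem ClassAtMost.mono {j k m : ℕ} {S : Set (Fin m → ℝ)} (h : ClassAtMost j m S) (hjk : j ≤ k) :
    ClassAtMost k m S := by
  induction hjk with
  | refl => exact h
  | step _ ih => exact ih.succ

theorem exists_snoc_eq_image {m : ℕ} (T : Set (Fin (m + 1) → ℝ)) :
    {x | ∃ a : ℝ, Fin.snoc (α := fun _ => ℝ) x a ∈ T} =
      LinearMap.funLeft ℝ ℝ (Fin.castSucc : Fin m → Fin (m + 1)) '' T := by
  ext x
  constructor
  · rintro ⟨a, ha⟩
    refine ⟨_, ha, ?_⟩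
    ext i
    simp [LinearMap.funLeft_apply]
  · rintro ⟨y, hy, rfl⟩
    refine ⟨y (Fin.last m), ?_⟩
    have : Fin.snoc (α := fun _ => ℝ) (LinearMap.funLeft ℝ ℝ Fin.castSucc y) (y (Fin.last m)) = y :=
      Fin.snoc_init_self (α := fun _ => ℝ) y
    rwa [this]

theorem ClassAtMost.empty (k m : ℕ) : ClassAtMost k m ∅ :=
  ClassAtMost.mono (j := 0) (S := ∅) ⟨⊥, by simp⟩ k.zero_le

theorem ClassAtMost.point (k : ℕ) : ClassAtMost k 1 point := by
  refine ClassAtMost.mono (j := 0) ⟨(LinearMap.ker (LinearMap.proj 0 :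
    (Fin 1 → ℝ) →ₗ[ℝ] ℝ)).toAffineSubspace, ?_⟩ k.zero_le
  ext x
  exact Iff.rfl

theorem ClassAtMost.preimage {k m n : ℕ} (g : (Fin m → ℝ) →ᵃ[ℝ] (Fin n → ℝ))
    {T : Set (Fin n → ℝ)} (h : ClassAtMost k n T) : ClassAtMost k m (g ⁻¹' T) := by
  match k with
  | 0 =>
    obtain ⟨A, rfl⟩ := h
    exact ⟨A.comap g, rfl⟩
  | 1 => exact ⟨h.1.affine_preimage g, h.2.1.preimage g,
      h.2.2.preimage (AffineMap.continuous_of_finiteDimensional g)⟩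
  | 2 => exact ⟨h.1.affine_preimage g, h.2.1.preimage g, h.2.2.preimage g⟩
  | 3 => exact ⟨h.1.affine_preimage g, h.2.preimage g⟩
  | 4 => exact ⟨h.1.affine_preimage g, h.2.preimage g⟩
  | _ + 5 => exact Convex.affine_preimage g h

theorem ClassAtMost.iInter {k m : ℕ} {ι : Type} {T : ι → Set (Fin m → ℝ)}
    (h : ∀ i, ClassAtMost k m (T i)) : ClassAtMost k m (⋂ i, T i) := by
  match k with
  | 0 =>
    choose A hA using h
    refine ⟨⨅ i, A i, ?_⟩
    rw [AffineSubspace.coe_iInf]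
    exact iInter_congr hA
  | 1 => exact ⟨convex_iInter fun i => (h i).1, DriftInvariant.iInter fun i => (h i).2.1,
      isClosed_iInter fun i => (h i).2.2⟩
  | 2 => exact ⟨convex_iInter fun i => (h i).1, DriftInvariant.iInter fun i => (h i).2.1,
      NoSemident.iInter fun i => (h i).2.2⟩
  | 3 => exact ⟨convex_iInter fun i => (h i).1, DriftInvariant.iInter fun i => (h i).2⟩
  | 4 => exact ⟨convex_iInter fun i => (h i).1, NoRay.iInter fun i => (h i).2⟩
  | _ + 5 => exact convex_iInter h

theorem ClassAtMost.image {k m n : ℕ} {T : Set (Fin m → ℝ)} (h : ClassAtMost k m T)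
    (f : (Fin m → ℝ) →ₗ[ℝ] (Fin n → ℝ)) : ClassAtMost k n (f '' T) := by
  match k with
  | 0 =>
    obtain ⟨A, rfl⟩ := h
    exact ⟨A.map f.toAffineMap, rfl⟩
  | 1 => exact ⟨h.1.linear_image f, h.2.1.image f, h.2.1.isClosed_image h.2.2 f⟩
  | 2 => exact ⟨h.1.linear_image f, h.2.1.image f, h.2.2.image h.2.1 f⟩
  | 3 => exact ⟨h.1.linear_image f, h.2.image f⟩
  | 4 => exact ⟨h.1.linear_image f, h.2.image h.1 f⟩
  | _ + 5 => exact Convex.linear_image h f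

/-- This bounds what is definable from a set at level `k`; at level 5 it says that definable sets
are convex. -/
theorem ClassAtMost.ppClosed (k : ℕ) : PPClosed (ClassAtMost k) where
  empty := ClassAtMost.empty k
  point := ClassAtMost.point k
  preimage g _ h := h.preimage g
  iInter := ClassAtMost.iInter
  proj h := by
    rw [exists_snoc_eq_image]
    exact h.image _

/-! ### The representatives -/

section Representatives

variable {C : ∀ m : ℕ, Set (Fin m → ℝ) → Prop}

theorem PPClosed.def_of_interval (hC : PPClosed C) {A : Set ℝ} (h : C 1 {x | x 0 ∈ A}) : Def C A :=
  (Def.of hC h).preimage (g := fun (x : ℝ) (_ : Fin 1) => x) (by fun_prop)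

theorem Def.interval_out {A : Set ℝ} (h : Def C A) : C 1 {x | x 0 ∈ A} :=
  (h.preimage (IsAff.apply (0 : Fin 1))).out

theorem PPClosed.def_of_plane (hC : PPClosed C) {A : Set (ℝ × ℝ)} (h : C 2 {x | (x 1, x 0) ∈ A}) :
    Def C A :=
  (Def.of hC h).preimage (g := fun (q : ℝ × ℝ) (i : Fin 2) => if i = 0 then q.2 else q.1)
    (IsAff.pi fun i => by split <;> fun_prop)

theorem Def.plane_out {A : Set (ℝ × ℝ)} (h : Def C A) : C 2 {x | (x 1, x 0) ∈ A} :=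
  (h.preimage (g := fun x : Fin 2 → ℝ => (x 1, x 0))
    ((IsAff.apply 1).prodMk (IsAff.apply 0))).out

theorem pointedRectangle_eq : pointedRectangle = {x | (x 1, x 0) ∈ rectangleGadget} := by
  ext x
  exact or_congr and_comm and_comm

theorem pointedStripe_eq : pointedStripe = {x | (x 1, x 0) ∈ stripeGadget} := by
  ext x
  exact or_congr Iff.rfl and_comm

/-- The members of a class are definable from its representative. -/
theorem ClassAtMost.of_representative (hC : PPClosed C) (k : Fin 6)
    (hk : C (representative k).1 (representative k).2) {m : ℕ} {S : Set (Fin m → ℝ)}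
    (hS : ClassAtMost k m S) : C m S := by
  fin_cases k
  · obtain ⟨A, rfl⟩ := hS
    exact (Def.of_affineSubspace hC A).out
  · exact (Def.of_isClosed hC (hC.def_of_interval hk) hS.1 hS.2.2 hS.2.1.noRay).out
  · exact (Def.of_noSemident hC (hC.def_of_interval hk) hS.1 hS.2.1 hS.2.2).out
  · refine (Def.of_rectangleGadget hC (hC.def_of_plane ?_) hS.1 hS.2).out
    rw [← pointedRectangle_eq]
    exact hk
  · refine (Def.of_stripeGadget hC (hC.def_of_plane ?_) hS.1 hS.2).out
    rw [← pointedStripe_eq]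
    exact hk
  · exact (Def.of_ray hC (hC.def_of_interval (A := Ici 0) hk) hS).out

/-- The representative of a class is definable from every member of exactly that class. -/
theorem PPClosed.representative (hC : PPClosed C) (k : Fin 6) {m : ℕ} {S : Set (Fin m → ℝ)}
    (hSC : C m S) (hS : ClassAtMost k m S) (hS' : ∀ j < (k : ℕ), ¬ ClassAtMost j m S) :
    C (ConvexPP.representative k).1 (ConvexPP.representative k).2 := by
  have hD := Def.of hC hSC
  fin_cases k
  · exact hC.point
  · exact (hD.icc_of_isClosed hS.1 hS.2.2 hS.2.1.noRay (hS' 0 (by decide))).interval_out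
  · exact (hD.ioo_of_not_isClosed hC hS.1 hS.2.1.noRay
      fun h => hS' 1 (by decide) ⟨hS.1, hS.2.1, h⟩).interval_out
  · have hsd : ¬ NoSemident S := fun h => hS' 2 (by decide) ⟨hS.1, hS.2, h⟩
    have hO := hD.ioo_of_not_isClosed hC hS.1 hS.2.noRay
      fun h => hS' 1 (by decide) ⟨hS.1, hS.2, h⟩
    have := (hD.rectangleGadget_of_semident hC hS.1 hO hsd).plane_out
    rwa [← pointedRectangle_eq] at this
  · have := (hD.stripeGadget_of_not_driftInvariant hC hS.1 hS.2
      fun h => hS' 3 (by decide) ⟨hS.1, h⟩).plane_out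
    rwa [← pointedStripe_eq] at this
  · exact (hD.ray_of_not_noRay hC hS fun h => hS' 4 (by decide) ⟨hS, h⟩).interval_out

theorem convex_interval {A : Set ℝ} (h : Convex ℝ A) : Convex ℝ {x : Fin 1 → ℝ | x 0 ∈ A} :=
  h.linear_preimage (LinearMap.proj 0 : (Fin 1 → ℝ) →ₗ[ℝ] ℝ)

theorem driftInvariant_interval {a b : ℝ} {A : Set ℝ} (h : A ⊆ Icc a b) :
    DriftInvariant {x : Fin 1 → ℝ | x 0 ∈ A} := by
  have h1 : DriftInvariant A := by
    have := driftInvariant_add_submodule ((Metric.isBounded_Icc a b).subset h) ⊥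
    simpa using this
  exact h1.preimage (LinearMap.proj 0 : (Fin 1 → ℝ) →ₗ[ℝ] ℝ).toAffineMap

theorem convex_pointedStripe : Convex ℝ pointedStripe := by
  rw [convex_iff_forall_pos]
  intro x hx y hy a b ha hb hab
  rcases hx with ⟨h1, h2⟩ | ⟨h1, h2⟩ <;> rcases hy with ⟨h3, h4⟩ | ⟨h3, h4⟩
  · left; constructor <;> simp <;> nlinarith
  · left; constructor <;> simp <;> nlinarith
  · left; constructor <;> simp <;> nlinarith
  · right; simp [h1, h2, h3, h4]

theorem convex_pointedRectangle : Convex ℝ pointedRectangle := by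
  rw [convex_iff_forall_pos]
  intro x hx y hy a b ha hb hab
  rcases hx with ⟨⟨h5, h6⟩, h1, h2⟩ | ⟨h1, h2⟩ <;> rcases hy with ⟨⟨h7, h8⟩, h3, h4⟩ | ⟨h3, h4⟩
  · left; refine ⟨⟨?_, ?_⟩, ?_, ?_⟩ <;> simp <;> nlinarith
  · left; refine ⟨⟨?_, ?_⟩, ?_, ?_⟩ <;> simp <;> nlinarith
  · left; refine ⟨⟨?_, ?_⟩, ?_, ?_⟩ <;> simp <;> nlinarith
  · right; simp [h1, h2, h3, h4]

/-- Along a ray the second coordinate is bounded, hence constant. If it is zero, the ray is the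
origin alone. -/
theorem noRay_pointedStripe : NoRay pointedStripe := by
  intro v w hvw x
  have hb : DriftInvariant (Ico (0 : ℝ) 1) := by
    have := driftInvariant_add_submodule (Metric.isBounded_Ico (0 : ℝ) 1) ⊥
    simpa using this
  have hmem : ∀ y : ℝ, 0 < y → v 1 + y • w 1 ∈ Ico (0 : ℝ) 1 := by
    intro y hy
    rcases hvw y hy with h | ⟨-, h⟩
    · exact ⟨h.1.le, h.2⟩
    · have h : v 1 + y • w 1 = 0 := h
      rw [h]
      exact ⟨le_rfl, one_pos⟩
  have hall := hb.noRay (v 1) (w 1) hmem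
  have hw1 : w 1 = 0 := by
    by_contra h0
    have := (hall ((1 - v 1) / w 1)).2
    rw [smul_eq_mul, div_mul_cancel₀ _ h0] at this
    linarith
  by_cases hv : v 1 = 0
  · have h0 : ∀ y : ℝ, 0 < y → v 0 + y * w 0 = 0 := by
      intro y hy
      rcases hvw y hy with h | ⟨h, -⟩
      · simp [hv, hw1] at h
      · exact h
    have h1 := h0 1 one_pos
    have h2 := h0 2 two_pos
    have h3 : w 0 = 0 := by linarith
    have h4 : v 0 = 0 := by rw [h3] at h1; linarith
    exact Or.inr ⟨by simp [h3, h4], by simp [hv, hw1]⟩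
  · rcases hvw 1 one_pos with h | ⟨-, h⟩
    · left
      simpa [hw1] using h
    · simp [hw1, hv] at h

theorem representative_classAtMost (k : Fin 6) :
    ClassAtMost k (representative k).1 (representative k).2 := by
  fin_cases k
  · exact ClassAtMost.point 0
  · exact ⟨convex_interval (convex_Icc 0 1), driftInvariant_interval Subset.rfl,
      isClosed_Icc.preimage (continuous_apply (0 : Fin 1))⟩
  · have hop : NoSemident (Ioo (0 : ℝ) 1) := by
      intro s hs t ht c hc
      rw [closure_Ioo (by norm_num)] at ht
      obtain ⟨h1, h2⟩ := hs
      obtain ⟨h3, h4⟩ := ht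
      obtain ⟨h5, h6⟩ := hc
      constructor <;> simp <;> nlinarith
    exact ⟨convex_interval (convex_Ioo 0 1), driftInvariant_interval Ioo_subset_Icc_self,
      hop.preimage (LinearMap.proj 0 : (Fin 1 → ℝ) →ₗ[ℝ] ℝ).toAffineMap⟩
  · have hb : Bornology.IsBounded pointedRectangle := by
      refine isBounded_iff_forall_norm_le.2 ⟨1, fun x hx => ?_⟩
      rw [pi_norm_le_iff_of_nonneg zero_le_one]
      rcases hx with ⟨⟨h1, h2⟩, h3, h4⟩ | ⟨h1, h2⟩
      · intro i
        fin_cases i <;> simp only [Real.norm_eq_abs, abs_le] <;> constructor <;> simp <;> linarith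
      · intro i
        fin_cases i <;> simp [h1, h2]
    have hB : DriftInvariant pointedRectangle := by
      have := driftInvariant_add_submodule hb ⊥
      simpa using this
    exact ⟨convex_pointedRectangle, hB⟩
  · exact ⟨convex_pointedStripe, noRay_pointedStripe⟩
  · exact convex_interval (convex_Ici 0)

theorem representative_not_classAtMost (k : Fin 6) {j : ℕ} (hj : j < (k : ℕ)) :
    ¬ ClassAtMost j (representative k).1 (representative k).2 := by
  intro h
  -- The levels increase, so only the level just below needs refuting.
  have h' := h.mono (Nat.le_sub_one_of_lt hj)
  clear h
  fin_cases k
  · simp at hj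
  · obtain ⟨A, hA⟩ : ∃ A : AffineSubspace ℝ (Fin 1 → ℝ), closedInterval = A := h'
    have h0 : (fun _ => 0 : Fin 1 → ℝ) ∈ A := by
      rw [← SetLike.mem_coe, ← hA]; exact ⟨le_rfl, zero_le_one⟩
    have h1 : (fun _ => 1 : Fin 1 → ℝ) ∈ A := by
      rw [← SetLike.mem_coe, ← hA]; exact ⟨zero_le_one, le_rfl⟩
    have h2 := AffineSubspace.smul_vsub_vadd_mem A 2 h1 h0 h0
    rw [← SetLike.mem_coe, ← hA] at h2
    have h3 := h2.2
    norm_num at h3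
  · have hcl : IsClosed openInterval := h'.2.2
    have : (fun _ => 0 : Fin 1 → ℝ) ∈ openInterval := by
      have hlim : Filter.Tendsto (fun n : ℕ => (fun _ => 1 / ((n : ℝ) + 1 + 1) : Fin 1 → ℝ))
          Filter.atTop (nhds fun _ => 0) := by
        rw [tendsto_pi_nhds]
        intro _
        have := (Filter.tendsto_add_atTop_iff_nat 1).2
          (tendsto_one_div_add_atTop_nhds_zero_nat (𝕜 := ℝ))
        simpa using this
      refine hcl.mem_of_tendsto hlim (Filter.Eventually.of_forall fun n => ?_)
      have hn := n.cast_nonneg (α := ℝ)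
      exact ⟨by positivity, by rw [div_lt_one (by positivity)]; linarith⟩
    exact lt_irrefl _ this.1
  · have hsd : NoSemident pointedRectangle := h'.2.2
    -- The semident is `(1/4, 0)`, halfway between the origin and this limit point.
    have ht : (![1 / 2, 0] : Fin 2 → ℝ) ∈ closure pointedRectangle := by
      have hlim : Filter.Tendsto (fun n : ℕ => (![1 / 2, 1 / ((n : ℝ) + 1 + 1)] : Fin 2 → ℝ))
          Filter.atTop (nhds ![1 / 2, 0]) := by
        rw [tendsto_pi_nhds]
        intro i
        fin_cases i
        · exact tendsto_const_nhds
        · have := (Filter.tendsto_add_atTop_iff_nat 1).2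
            (tendsto_one_div_add_atTop_nhds_zero_nat (𝕜 := ℝ))
          simpa using this
      refine mem_closure_of_tendsto hlim (Filter.Eventually.of_forall fun n => Or.inl ?_)
      have hn := n.cast_nonneg (α := ℝ)
      refine ⟨⟨by norm_num, by norm_num⟩, ?_, ?_⟩
      · change 0 < 1 / ((n : ℝ) + 1 + 1)
        positivity
      · change 1 / ((n : ℝ) + 1 + 1) < 1
        rw [div_lt_one (by positivity)]
        linarith
    have := hsd 0 (Or.inr ⟨rfl, rfl⟩) _ ht (1 / 2) ⟨by norm_num, by norm_num⟩
    rcases this with ⟨-, h1, -⟩ | ⟨h1, -⟩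
    · simp at h1
    · norm_num at h1
  · have hB : DriftInvariant pointedStripe := h'.2
    have hw : (![1, 0] : Fin 2 → ℝ) ∈ drift pointedStripe := by
      refine mem_drift.2 fun f ⟨c, hc⟩ => ?_
      by_contra h0
      -- The first coordinate is chosen so that `f` exceeds its bound `c` unless it kills the
      -- horizontal direction. The origin cannot be moved in that direction.
      have key := hc (![(c + 1 + |f ![0, 1 / 2]|) / f ![1, 0], 1 / 2])
        (Or.inl ⟨by norm_num, by norm_num⟩)
      have e : (![(c + 1 + |f ![0, 1 / 2]|) / f ![1, 0], 1 / 2] : Fin 2 → ℝ) =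
          ((c + 1 + |f ![0, 1 / 2]|) / f ![1, 0]) • ![1, 0] + ![0, 1 / 2] := by
        ext i; fin_cases i <;> simp
      rw [e, map_add, map_smul, smul_eq_mul, div_mul_cancel₀ _ h0] at key
      have h1 := (le_abs_self _).trans key
      have h2 := neg_abs_le (f ![0, 1 / 2])
      linarith
    have := hB _ hw 0 (Or.inr ⟨rfl, rfl⟩)
    rcases this with ⟨h1, -⟩ | ⟨h1, -⟩
    · simp at h1
    · simp at h1
  · have hray : NoRay ray := h'.2
    have h1 := hray 0 (fun _ => 1) (fun x hx => by
      change (0 : ℝ) ≤ 0 + x * 1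
      linarith) (-1)
    have h2 : (0 : ℝ) ≤ 0 + (-1) * 1 := h1
    norm_num at h2

end Representatives

/-! ### The geometric description of the classes -/

section Geometric

variable {n : ℕ} {S : Set (Fin n → ℝ)}

theorem isBoundedConvexPlusSubspace_iff (hS : Convex ℝ S) :
    IsBoundedConvexPlusSubspace S ↔ DriftInvariant S := by
  constructor
  · rintro ⟨B, V, hB, -, rfl⟩
    exact driftInvariant_add_submodule hB V
  · intro h
    obtain ⟨P, hb, hP⟩ := h.exists_eq_add
    exact ⟨_, drift S, hb, hS.inter (convex_fixed P), hP⟩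

theorem isBoundedPlusSubspace_iff (hS : Convex ℝ S) :
    IsBoundedPlusSubspace S ↔ DriftInvariant S := by
  rw [← isBoundedConvexPlusSubspace_iff hS]
  constructor
  · rintro ⟨B, V, hB, rfl⟩
    exact (isBoundedConvexPlusSubspace_iff hS).2 (driftInvariant_add_submodule hB V)
  · rintro ⟨B, V, hB, -, h⟩
    exact ⟨B, V, hB, h⟩

theorem isCompactPlusSubspace_iff (hS : Convex ℝ S) :
    IsCompactPlusSubspace S ↔ DriftInvariant S ∧ IsClosed S := by
  constructor
  · rintro ⟨B, V, hB, -, rfl⟩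
    exact ⟨driftInvariant_add_submodule hB.isBounded V, isClosed_add_submodule hB V⟩
  · rintro ⟨h, hcl⟩
    obtain ⟨P, hb, hP⟩ := h.exists_eq_add
    have hPcl : IsClosed {x | P x = x} :=
      isClosed_eq (LinearMap.continuous_of_finiteDimensional P) continuous_id
    exact ⟨_, drift S, Metric.isCompact_of_isClosed_isBounded (hcl.inter hPcl) hb,
      hS.inter (convex_fixed P), hP⟩

theorem exists_isSemident_iff : (∃ a, IsSemident S a) ↔ ¬ NoSemident S := by
  constructor
  · rintro ⟨_, ha, s, hs, t, ht, c, hc, rfl⟩ h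
    exact ha (h s hs t ht c hc)
  · intro h
    simp only [NoSemident] at h
    push Not at h
    obtain ⟨s, hs, t, ht, c, hc, h⟩ := h
    exact ⟨_, h, s, hs, t, ht, c, hc, rfl⟩

theorem hasRayIntersection_iff (hS : Convex ℝ S) : HasRayIntersection S ↔ ¬ NoRay S := by
  constructor
  · rintro ⟨v, w, h1, h2⟩ h
    exact h2 (-1) (by norm_num) (h v w h1 (-1))
  · intro h
    simp only [NoRay] at h
    push Not at h
    obtain ⟨v, w, hvw, x₀, hx₀⟩ := h
    let A : Set ℝ := {x | v + x • w ∈ S}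
    have hA : Convex ℝ A := Convex.preimage_isAff hS (isAff_line v w)
    have hlow : ∀ x ∈ A, x₀ ≤ x := fun x hx => by
      by_contra! hlt
      exact hx₀ (hA.ordConnected.out hx (hvw (|x₀| + 1) (by positivity))
        ⟨hlt.le, by have := le_abs_self x₀; linarith⟩)
    -- `HasRayIntersection` leaves the parameter zero free, so the ray may start at the infimum
    -- whether or not that point belongs to `S`.
    refine ⟨v + sInf A • w, w, fun x hx => ?_, fun x hx hmem => ?_⟩
    · rw [add_assoc, ← add_smul]
      obtain ⟨y, hy, hlt⟩ := exists_lt_of_csInf_lt ⟨1, hvw 1 one_pos⟩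
        (by linarith : sInf A < sInf A + x)
      rcases le_or_gt (sInf A + x) 0 with h0 | h0
      · exact hA.ordConnected.out hy (hvw 1 one_pos) ⟨hlt.le, by linarith⟩
      · exact hvw _ h0
    · rw [add_assoc, ← add_smul] at hmem
      have := csInf_le ⟨x₀, hlow⟩ (show sInf A + x ∈ A from hmem)
      linarith

theorem definableFrom_ppClosed (S : Set (Fin n → ℝ)) : PPClosed fun _ T => DefinableFrom S T :=
  IPPDefinable.ppClosed _

theorem ClassAtMost.of_definableFrom {k m : ℕ} {T : Set (Fin m → ℝ)} (hS : ClassAtMost k n S)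
    (h : DefinableFrom S T) : ClassAtMost k m T := by
  refine (ClassAtMost.ppClosed k).of_definable ?_
    (show IPPDefinable {(⟨n, S⟩ : RealRel)} T from h)
  rintro _ rfl
  exact hS

/-- Interdefinable sets occupy the same levels, and a set with the same least level as the
representative is interdefinable with it. -/
theorem inClass_iff (k : Fin 6) :
    InClass k S ↔ ClassAtMost k n S ∧ ∀ j < (k : ℕ), ¬ ClassAtMost j n S := by
  constructor
  · rintro ⟨h1, h2⟩
    exact ⟨(representative_classAtMost k).of_definableFrom h1,
      fun j hj h => representative_not_classAtMost k hj (h.of_definableFrom h2)⟩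
  · rintro ⟨h1, h2⟩
    exact ⟨ClassAtMost.of_representative (definableFrom_ppClosed _) k
        (IPPDefinable.rel rfl) h1,
      (definableFrom_ppClosed S).representative k (IPPDefinable.rel rfl) h1 h2⟩

theorem exists_inClass {k : Fin 6} (hk : ClassAtMost k n S) :
    ∃ j ≤ k, InClass j S := by
  classical
  have hex : ∃ j, ClassAtMost j n S := ⟨k, hk⟩
  have hle : Nat.find hex ≤ k := Nat.find_min' hex hk
  refine ⟨⟨Nat.find hex, hle.trans_lt k.2⟩, hle, (inClass_iff _).2 ⟨Nat.find_spec hex, ?_⟩⟩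
  exact fun j hj => Nat.find_min hex hj

theorem InClass.unique {j k : Fin 6} (hj : InClass j S) (hk : InClass k S) :
    j = k := by
  rw [inClass_iff] at hj hk
  rcases lt_trichotomy j k with h | h | h
  · exact absurd hj.1 (hk.2 j h)
  · exact h
  · exact absurd hk.1 (hj.2 k h)

theorem inClass_iff_of_pos (k : ℕ) (hk : k + 1 < 6) :
    InClass ⟨k + 1, hk⟩ S ↔ ClassAtMost (k + 1) n S ∧ ¬ ClassAtMost k n S := by
  rw [inClass_iff]
  exact and_congr_right fun _ => ⟨fun h => h k k.lt_succ_self,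
    fun h j hj hj' => h (hj'.mono (Nat.le_of_lt_succ hj))⟩

end Geometric

end Classes

end ConvexPP

/-! ### The theorem -/

open ConvexPP in
theorem theorem3p1 :
    -- the geometric description of the six classes
    (∀ (n : ℕ) (S : Set (Fin n → ℝ)), Convex ℝ S →
      (InClass 0 S ↔ IsEmptyOrAffine S) ∧
      (InClass 1 S ↔ ¬ IsEmptyOrAffine S ∧ IsCompactPlusSubspace S) ∧
      (InClass 2 S ↔
        ¬ IsClosed S ∧ (¬ ∃ a, IsSemident S a) ∧ IsBoundedConvexPlusSubspace S) ∧
      (InClass 3 S ↔ IsBoundedConvexPlusSubspace S ∧ ∃ a, IsSemident S a) ∧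
      (InClass 4 S ↔ ¬ IsBoundedPlusSubspace S ∧ ¬ HasRayIntersection S) ∧
      (InClass 5 S ↔ HasRayIntersection S)) ∧
    -- every convex set is in exactly one class
    (∀ (n : ℕ) (S : Set (Fin n → ℝ)), Convex ℝ S → ∃! k : Fin 6, InClass k S) ∧
    -- the sets definable from a convex set are the convex sets of equal or lower class number
    (∀ (n : ℕ) (S : Set (Fin n → ℝ)), Convex ℝ S → ∀ k : Fin 6, InClass k S →
      ∀ (m : ℕ) (T : Set (Fin m → ℝ)),
        DefinableFrom S T ↔ Convex ℝ T ∧ ∃ j : Fin 6, j ≤ k ∧ InClass j T) ∧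
    -- no non-convex set is definable from convex sets
    (∀ τ : Set RealRel, (∀ R ∈ τ, Convex ℝ R.2) →
      ∀ (m : ℕ) (T : Set (Fin m → ℝ)), IPPDefinable τ T → Convex ℝ T) := by
  refine ⟨fun n S hS => ?_, fun n S hS => ?_, fun n S hS k hk m T => ?_, fun τ hτ m T hT => ?_⟩
  · rw [isBoundedConvexPlusSubspace_iff hS, isBoundedPlusSubspace_iff hS,
      isCompactPlusSubspace_iff hS, exists_isSemident_iff, hasRayIntersection_iff hS]
    have h0 : InClass 0 S ↔ IsEmptyOrAffine S := by
      rw [inClass_iff]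
      exact ⟨fun h => h.1, fun h => ⟨h, fun j hj => absurd hj (Nat.not_lt_zero j)⟩⟩
    have h1 : InClass 1 S ↔ (Convex ℝ S ∧ DriftInvariant S ∧ IsClosed S) ∧ ¬ IsEmptyOrAffine S :=
      inClass_iff_of_pos 0 (by decide)
    have h2 : InClass 2 S ↔ (Convex ℝ S ∧ DriftInvariant S ∧ NoSemident S) ∧
        ¬ (Convex ℝ S ∧ DriftInvariant S ∧ IsClosed S) := inClass_iff_of_pos 1 (by decide)
    have h3 : InClass 3 S ↔ (Convex ℝ S ∧ DriftInvariant S) ∧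
        ¬ (Convex ℝ S ∧ DriftInvariant S ∧ NoSemident S) := inClass_iff_of_pos 2 (by decide)
    have h4 : InClass 4 S ↔ (Convex ℝ S ∧ NoRay S) ∧ ¬ (Convex ℝ S ∧ DriftInvariant S) :=
      inClass_iff_of_pos 3 (by decide)
    have h5 : InClass 5 S ↔ Convex ℝ S ∧ ¬ (Convex ℝ S ∧ NoRay S) :=
      inClass_iff_of_pos 4 (by decide)
    simp only [hS, true_and] at h1 h2 h3 h4 h5
    rw [h0, h1, h2, h3, h4, h5]
    have hB : DriftInvariant S → NoRay S := DriftInvariant.noRay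
    generalize IsEmptyOrAffine S = A, DriftInvariant S = B, IsClosed S = K, NoSemident S = N,
      NoRay S = R at hB
    clear h0 h1 h2 h3 h4 h5
    tauto
  · obtain ⟨j, -, hj⟩ := exists_inClass (k := 5) hS
    exact ⟨j, hj, fun k hk => hk.unique hj⟩
  · have hSk := ((inClass_iff k).1 hk).1
    constructor
    · intro h
      have hTk := hSk.of_definableFrom h
      have hT : Convex ℝ T := hTk.mono (k := 5) (Nat.le_of_lt_succ k.2)
      exact ⟨hT, exists_inClass hTk⟩
    · rintro ⟨hT, j, hjk, hj⟩
      exact ClassAtMost.of_representative (definableFrom_ppClosed S) k hk.2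
        (((inClass_iff j).1 hj).1.mono hjk)
  · exact (ClassAtMost.ppClosed 5).of_definable hτ hT
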